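/- **Setting.** Let $\mathcal X$ be a compact metric space of allocations that contains an outside option $\varnothing$ (possibly as an isolated point), let $\mathcal T=[\underline t,\overline t]$ with $\underline t<\overline t$, and let $v:\mathcal X\times\mathcal T\to\mathbb R$ satisfy: $v(\varnothing,t)=0$ for all $t$; for $x\neq\varnothing$, $v(x,\cdot)$ is positive and strictly increasing; $v$ is differentiable in $t$ with $v_t$ continuous on $\mathcal X\times\mathcal T$; and, for every $t$, $v(\cdot,t)$ is continuous at $\varnothing$ (automatic if $\varnothing$ is isolated). A *type distribution* is a continuously differentiable distribution function $F$ on $\mathcal T$ with positive density $f$. A *welfare weight* for $F$ is a continuous non-increasing $\lambda:\mathcal T\to[0,\infty)$ with $\mathbb E_F[\lambda(t)]\le 1$. A *mechanism* is a measurable map $(x,p):\mathcal T\to\mathcal X\times\mathbb R$ with $v(x(t),t)-p(t)\ge v(x(\hat t),t)-p(\hat t)$ and $v(x(t),t)-p(t)\ge 0$ for all $t,\hat t\in\mathcal T$. It is *optimal* for $(F,\lambda)$ if it maximizes $\mathbb E_F[\lambda(t)(v(x(t),t)-p(t))]+\mathbb E_F[p(t)]$ among all mechanisms. A set $\mathcal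 Y\subseteq\mathcal X$ is an *optimal menu* for $(F,\lambda)$ if there is an optimal mechanism $(x,p)$ with $x(t)\in\mathcal Y\cup\{\varnothing\}$ for all $t$. Given $F$, the demand curve of $x$ is $P(x,q)=v(x,F^{-1}(1-q))$ for $q\in[0,1]$, and the elasticity curve of $x\ne\varnothing$ is $\eta(x,q)=\left|\frac{d\log P(x,q)}{d\log q}\right|^{-1}\in(0,\infty]$ for $q\in(0,1)$. Write $x\preceq_{\text{surplus}}x'$ if $P(x,q)\le P(x',q)$ for all $q$, and $x\preceq_{\text{elasticity}}x'$ if $\eta(x,q)\le\eta(x',q)$ for all $q$; write $\prec$ if the inequality is strict for all $q\in(0,1)$. A compact set $\mathcal X^\star\subseteq\mathcal X$ is a *surplus-elasticity frontier* for $F$ if (i) for every $x\notin\mathcal X^\star$ with $x\neq\varnothing$ there is $x'\in\mathcal X^\star\setminus\{\varnothing\}$ with $x\preceq_{\text{surplus}}x'$ and $x\preceq_{\text{elasticity}}x'$; and (ii) there is $S\subseteq\mathbb R$ with $\mathcal X^\star\setminus\{\varnothing\}=\{x_s\}_{s\in S}$ such that for all $s<s'$ in $S$, $x_s\prec_{\text{surplus}}x_{s'}$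 and $x_{s'}\prec_{\text{elasticity}}x_s$. **Theorem.** If $\mathcal X^\star$ is a surplus-elasticity frontier for some type distribution $F_0$, then for every type distribution $F$ and every welfare weight $\lambda$ for $F$, $\mathcal X^\star$ is an optimal menu for $(F,\lambda)$. -/

import Mathlib

open Set

/-- A one-dimensional screening environment. The type `X` is the allocation space together with
the outside option (a compact metric space in the theorem), types are `t ∈ [tlo, thi]`, and
`v x t` is the value of allocation `x` to type `t`. Values of `v` at types outside
`[tlo, thi]` are never used. -/
structure ScreeningEnv (X : Type*) [MetricSpace X] where
  /-- lowest type -/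
  tlo : ℝ
  /-- highest type -/
  thi : ℝ
  /-- the outside option -/
  outside : X
  /-- value of an allocation to a type -/
  v : X → ℝ → ℝ
  tlo_lt_thi : tlo < thi
  /-- the outside option gives every type payoff zero -/
  v_outside : ∀ t ∈ Icc tlo thi, v outside t = 0
  /-- any other allocation has positive value for every type -/
  v_pos : ∀ x, x ≠ outside → ∀ t ∈ Icc tlo thi, 0 < v x t
  /-- the value of any other allocation is strictly increasing in the type -/
  v_strictMonoOn : ∀ x, x ≠ outside → StrictMonoOn (v x) (Icc tlo thi)
  v_differentiableOn : ∀ x, DifferentiableOn ℝ (v x) (Icc tlo thi)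
  /-- `v_t` is jointly continuous in allocation and type -/
  v_t_continuousOn :
    ContinuousOn (fun z : X × ℝ => derivWithin (v z.1) (Icc tlo thi) z.2)
      (univ ×ˢ Icc tlo thi)
  /-- This holds automatically when the outside option is an isolated point, that is, when it is
  adjoined to a compact space of allocations. It is a restriction only if other allocations
  converge to the outside option, which is also allowed here. -/
  v_continuousAt_outside : ∀ t ∈ Icc tlo thi, ContinuousAt (fun x => v x t) outside

namespace ScreeningEnv

variable {X : Type*} [MetricSpace X] (E : ScreeningEnv X)

/-- The type space `[tlo, thi]`. -/
def types : Set ℝ := Icc E.tlo E.thi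

/-- `f` is a positive continuous density on the type space, i.e. the density of a
continuously differentiable distribution function. -/
structure IsTypeDensity (f : ℝ → ℝ) : Prop where
  continuousOn : ContinuousOn f E.types
  pos : ∀ t ∈ E.types, 0 < f t
  integral_eq_one : ∫ t in E.tlo..E.thi, f t = 1

/-- The distribution function `F` with density `f`. -/
noncomputable def cdf (f : ℝ → ℝ) (t : ℝ) : ℝ := ∫ s in E.tlo..t, f s

/-- The quantile function `F⁻¹ : [0, 1] → [tlo, thi]`. -/
noncomputable def quantile (f : ℝ → ℝ) (y : ℝ) : ℝ := sInf {t | t ∈ E.types ∧ y ≤ E.cdf f t}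

/-- Expectation of a function of the type. -/
noncomputable def expect (f g : ℝ → ℝ) : ℝ := ∫ t in E.tlo..E.thi, g t * f t

/-- Redistributive welfare weights: continuous, nonnegative, non-increasing, with mean at most
one. -/
structure IsWelfareWeight (f lam : ℝ → ℝ) : Prop where
  continuousOn : ContinuousOn lam E.types
  nonneg : ∀ t ∈ E.types, 0 ≤ lam t
  antitoneOn : AntitoneOn lam E.types
  expect_le_one : E.expect f lam ≤ 1

/-- A (direct-revelation) mechanism: a measurable allocation and payment rule on the type space
satisfying incentive compatibility and individual rationality. -/
structure IsMechanism [MeasurableSpace X] (x : ℝ → X) (p : ℝ → ℝ) : Prop where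
  measurable_alloc : Measurable (E.types.domRestrict x)
  measurable_pay : Measurable (E.types.domRestrict p)
  ic : ∀ t ∈ E.types, ∀ t' ∈ E.types, E.v (x t') t - p t' ≤ E.v (x t) t - p t
  ir : ∀ t ∈ E.types, 0 ≤ E.v (x t) t - p t

/-- The principal's objective: expected weighted agent welfare plus expected revenue. -/
noncomputable def objective (f lam : ℝ → ℝ) (x : ℝ → X) (p : ℝ → ℝ) : ℝ :=
  E.expect f (fun t => lam t * (E.v (x t) t - p t)) + E.expect f p

/-- A mechanism that is optimal among all mechanisms. -/
def IsOptimalMechanism [MeasurableSpace X] (f lam : ℝ → ℝ) (x : ℝ → X) (p : ℝ → ℝ) : Prop :=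
  E.IsMechanism x p ∧
    ∀ (x' : ℝ → X) (p' : ℝ → ℝ), E.IsMechanism x' p' →
      E.objective f lam x' p' ≤ E.objective f lam x p

/-- A menu `Y`, to which the outside option is always added, is optimal if some optimal mechanism
(in the whole allocation space) only uses allocations from the menu. -/
def IsOptimalMenu [MeasurableSpace X] (f lam : ℝ → ℝ) (Y : Set X) : Prop :=
  ∃ (x : ℝ → X) (p : ℝ → ℝ), E.IsOptimalMechanism f lam x p ∧
    ∀ t ∈ E.types, x t ∈ insert E.outside Y

/-- The demand curve `P(x, q) = v(x, F⁻¹(1 - q))`. -/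
noncomputable def demand (f : ℝ → ℝ) (x : X) (q : ℝ) : ℝ := E.v x (E.quantile f (1 - q))

/-- The elasticity curve `η(x, q) = |d log P(x, q) / d log q|⁻¹`, with value `∞` where the
derivative vanishes. The derivative in `log q` is that of `r ↦ log P(x, exp r)` at `r = log q`. -/
noncomputable def elasticity (f : ℝ → ℝ) (x : X) (q : ℝ) : ENNReal :=
  (ENNReal.ofReal |deriv (fun r => Real.log (E.demand f x (Real.exp r))) (Real.log q)|)⁻¹

/-- Weak surplus order. -/
def SurplusLE (f : ℝ → ℝ) (x x' : X) : Prop :=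
  ∀ q ∈ Icc (0 : ℝ) 1, E.demand f x q ≤ E.demand f x' q

/-- Weak elasticity order. -/
def ElasticityLE (f : ℝ → ℝ) (x x' : X) : Prop :=
  ∀ q ∈ Ioo (0 : ℝ) 1, E.elasticity f x q ≤ E.elasticity f x' q

/-- Strict surplus order. -/
def SurplusLT (f : ℝ → ℝ) (x x' : X) : Prop :=
  ∀ q ∈ Ioo (0 : ℝ) 1, E.demand f x q < E.demand f x' q

/-- Strict elasticity order. -/
def ElasticityLT (f : ℝ → ℝ) (x x' : X) : Prop :=
  ∀ q ∈ Ioo (0 : ℝ) 1, E.elasticity f x q < E.elasticity f x' q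

/-- A surplus-elasticity frontier. Only allocations other than the outside option are compared,
since elasticities are defined for these only; it is immaterial whether the set itself contains
the outside option. -/
structure IsFrontier (f : ℝ → ℝ) (Y : Set X) : Prop where
  isCompact : IsCompact Y
  /-- Every other allocation is dominated in both orders by an element of the frontier. -/
  dominates : ∀ x, x ∉ Y → x ≠ E.outside →
    ∃ x' ∈ Y \ {E.outside}, E.SurplusLE f x x' ∧ E.ElasticityLE f x x'
  /-- The frontier can be indexed by reals so that higher elements have strictly higher and
  strictly less elastic demand curves. -/
  ordered : ∃ (S : Set ℝ) (e : ℝ → X), e '' S = Y \ {E.outside} ∧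
    ∀ s ∈ S, ∀ s' ∈ S, s < s' →
      E.SurplusLT f (e s) (e s') ∧ E.ElasticityLT f (e s') (e s)

end ScreeningEnv

/-! At the quantile `q = 1 - F(t)` the inverse elasticity of `x` is `(v_t / v)(x, t)` times `(1 -
F(t)) / f(t)`, a factor common to all allocations. The frontier conditions therefore only compare
`v` and `v_t / v` type by type, and hold for every distribution once they hold for one. With the
outside option added, the frontier becomes a compact chain on which value, slope and growth rate of
value increase together, and each allocation has a counterpart in the chain with higher value and
lower growth rate (`IsFrontier.isDominantChain`).

Take any mechanism and sample finitely many types. Replace the allocation of type `t` by a lottery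
that yields its counterpart with the probability that leaves `t` equally well off. The lottery grows
more slowly in the type than the original allocation, so no higher type is tempted by it; lower
types may be. Hence only the constraints against imitating lower types survive, together with
participation (`IsMechanism.exists_feasible`).

The core is this relaxed problem. At an optimum, with ties broken towards higher prices and then
lower ranks, prices increase in the type: if two adjacent types paid decreasing prices, moving the
higher type to the option or price of the lower one, or conversely, would be an improvement, since
welfare weights decrease (`LocallyOptimal.price_le_succ`). Increasing prices make the values and
ranks of the options increase too. The lotteries can then be rewritten as a mixture of increasing
deterministic assignments that gives each type the same mean value out of goods of no higher rank
(`exists_increasing_lottery`). Virtual surplus per unit of value falls with the rank, because the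
tails of `(1 - λ) f` are nonnegative, so the mixture is at least as good, and so is one of its
members (`exists_increasing`).

An increasing assignment in the chain satisfies all incentive constraints under its envelope
payments (`IsIncreasing.isMechanism`). Refining the sample shows that such assignments approach the
value of any mechanism (`IsMechanism.exists_isIncreasing`), and Helly selection shows that one of
them attains their supremum (`IsDominantChain.exists_isOptimalMechanism`). -/

/-! ### Finitely many types -/

namespace FiniteScreening

variable {ι : Type*} {w : ι → ℕ → ℝ} {rk : ι → ℝ}

/-- Values `w k i` of goods `k` to types `i`, such that goods of higher rank are more valuable and
have values that increase proportionally faster in the type. -/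
structure RankedValues (w : ι → ℕ → ℝ) (rk : ι → ℝ) : Prop where
  nonneg : ∀ k i, 0 ≤ w k i
  eq_zero : ∀ k i j, w k i = 0 → w k j = 0
  mono_type : ∀ k, Monotone (w k)
  mono_rank : ∀ k l, rk k ≤ rk l → ∀ i, w k i ≤ w l i
  cross : ∀ k l i j, rk k ≤ rk l → i ≤ j → w k j * w l i ≤ w l j * w k i

/-- The value to type `i` of an option: a good, the probability of receiving it, and a price. -/
def worth (w : ι → ℕ → ℝ) (o : ι × ℝ × ℝ) (i : ℕ) : ℝ := o.2.1 * w o.1 i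

/-- The payoff of type `i` from an option. -/
def payoff (w : ι → ℕ → ℝ) (o : ι × ℝ × ℝ) (i : ℕ) : ℝ := worth w o i - o.2.2

/-- Assignments of options to the types `i < n`, with prices in `[lo, hi]`, such that no type
prefers the option of a lower type. -/
structure Feasible (w : ι → ℕ → ℝ) (n : ℕ) (lo hi : ℝ) (s : ℕ → ι × ℝ × ℝ) : Prop where
  prob : ∀ i, (s i).2.1 ∈ Icc (0 : ℝ) 1
  price : ∀ i, (s i).2.2 ∈ Icc lo hi
  ic : ∀ i j, i < j → j < n → payoff w (s i) j ≤ payoff w (s j) j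
  ir : ∀ i, i < n → 0 ≤ payoff w (s i) i

/-- The contribution of type `i` to the objective. -/
def contribution (w : ι → ℕ → ℝ) (lam : ℕ → ℝ) (o : ι × ℝ × ℝ) (i : ℕ) : ℝ :=
  lam i * payoff w o i + o.2.2

/-- The objective with masses `f` and welfare weights `lam`. -/
def welfare (w : ι → ℕ → ℝ) (f lam : ℕ → ℝ) (n : ℕ) (s : ℕ → ι × ℝ × ℝ) : ℝ :=
  ∑ i ∈ Finset.range n, f i * contribution w lam (s i) i

section Growth

/-- An increment is the level at `j` times the growth rate of the good. The second option has the
higher level by assumption and the higher rate by rank; probabilities do not affect rates. -/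
theorem growth (hw : RankedValues w rk) {o o' : ι × ℝ × ℝ} {j m : ℕ} (hjm : j ≤ m)
    (h0 : 0 ≤ o.2.1) (h0' : 0 ≤ o'.2.1)
    (hrk : rk o.1 ≤ rk o'.1) (h : worth w o j ≤ worth w o' j) :
    worth w o m - worth w o j ≤ worth w o' m - worth w o' j := by
  unfold worth at *
  obtain ⟨k, ρ, p⟩ := o
  obtain ⟨l, σ, q⟩ := o'
  simp only at *
  have hk := hw.nonneg k j
  have hlm := hw.mono_type l hjm
  have hkm := hw.mono_type k hjm
  have hkl := hw.mono_rank k l hrk j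
  have hc := hw.cross k l j m hrk hjm
  rcases hk.eq_or_lt with hk0 | hk0
  · have := hw.eq_zero k j m hk0.symm
    rw [this, ← hk0]
    nlinarith
  · have hl0 : 0 < w l j := lt_of_lt_of_le hk0 hkl
    have h1 : (w k m - w k j) / w k j ≤ (w l m - w l j) / w l j := by
      rw [div_le_div_iff₀ hk0 hl0]; nlinarith
    have h2 : 0 ≤ (w k m - w k j) / w k j := div_nonneg (by linarith) hk0.le
    calc ρ * w k m - ρ * w k j = (ρ * w k j) * ((w k m - w k j) / w k j) := by
          field_simp
      _ ≤ (σ * w l j) * ((w l m - w l j) / w l j) :=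
          mul_le_mul h h1 h2 (mul_nonneg h0' hl0.le)
      _ = σ * w l m - σ * w l j := by field_simp

theorem growth_payoff (hw : RankedValues w rk) {o o' : ι × ℝ × ℝ} {j m : ℕ} (hjm : j ≤ m)
    (h0 : 0 ≤ o.2.1) (h0' : 0 ≤ o'.2.1)
    (hrk : rk o.1 ≤ rk o'.1) (h : worth w o j ≤ worth w o' j)
    (hp : payoff w o j ≤ payoff w o' j) : payoff w o m ≤ payoff w o' m := by
  have := growth hw hjm h0 h0' hrk h
  unfold payoff at *
  linarith

end Growth

/-! ### Optima of the relaxed problem with lexicographic tie-breaking -/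

/-- Local optimality: no feasible change of the option of a single type raises its contribution,
or keeps it and raises its price, or keeps both and lowers the rank of its good. -/
def LocallyOptimal (w : ι → ℕ → ℝ) (rk : ι → ℝ) (lam : ℕ → ℝ) (n : ℕ) (lo hi : ℝ)
    (s : ℕ → ι × ℝ × ℝ) : Prop :=
  ∀ a < n, ∀ o : ι × ℝ × ℝ, o.2.1 ∈ Icc (0 : ℝ) 1 → o.2.2 ∈ Icc lo hi →
    (∀ i < a, payoff w (s i) a ≤ payoff w o a) →
    (∀ m, a < m → m < n → payoff w o m ≤ payoff w (s m) m) → 0 ≤ payoff w o a →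
    contribution w lam o a ≤ contribution w lam (s a) a ∧
    (contribution w lam o a = contribution w lam (s a) a → o.2.2 ≤ (s a).2.2 ∧
      (o.2.2 = (s a).2.2 → rk (s a).1 ≤ rk o.1))

theorem Feasible.update {n : ℕ} {lo hi : ℝ} {s : ℕ → ι × ℝ × ℝ} (hs : Feasible w n lo hi s)
    {a : ℕ} {o : ι × ℝ × ℝ} (ho : o.2.1 ∈ Icc (0 : ℝ) 1) (hp : o.2.2 ∈ Icc lo hi)
    (h1 : ∀ i < a, payoff w (s i) a ≤ payoff w o a)
    (h2 : ∀ m, a < m → m < n → payoff w o m ≤ payoff w (s m) m) (h3 : 0 ≤ payoff w o a) :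
    Feasible w n lo hi (Function.update s a o) where
  prob i := by
    rcases eq_or_ne i a with rfl | h
    · simpa using ho
    · simpa [Function.update_of_ne h] using hs.prob i
  price i := by
    rcases eq_or_ne i a with rfl | h
    · simpa using hp
    · simpa [Function.update_of_ne h] using hs.price i
  ic i j hij hj := by
    rcases eq_or_ne i a with rfl | h
    · simpa [Function.update_of_ne hij.ne'] using h2 j hij hj
    · rcases eq_or_ne j a with rfl | h'
      · simpa [Function.update_of_ne h] using h1 i hij
      · simpa [Function.update_of_ne h, Function.update_of_ne h'] using hs.ic i j hij hj
  ir i hi := by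
    rcases eq_or_ne i a with rfl | h
    · simpa using h3
    · simpa [Function.update_of_ne h] using hs.ir i hi

theorem sum_range_update {s : ℕ → ι × ℝ × ℝ} {a n : ℕ} (ha : a < n) (o : ι × ℝ × ℝ)
    (g : ι × ℝ × ℝ → ℕ → ℝ) :
    ∑ i ∈ Finset.range n, g (Function.update s a o i) i
      = ∑ i ∈ Finset.range n, g (s i) i + (g o a - g (s a) a) := by
  rw [← Finset.add_sum_erase _ _ (Finset.mem_range.2 ha),
    ← Finset.add_sum_erase _ (fun i => g (s i) i) (Finset.mem_range.2 ha),
    Finset.sum_congr rfl fun i hi => by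
      rw [Function.update_of_ne (Finset.ne_of_mem_erase hi)]]
  simp only [Function.update_self]
  ring

/-- A feasible assignment can be improved to a locally optimal one. -/
theorem exists_locallyOptimal [TopologicalSpace ι] [CompactSpace ι] (hwc : ∀ i, Continuous (w · i))
    (hrk : Continuous rk) {f lam : ℕ → ℝ} {n : ℕ} (hf : ∀ i < n, 0 < f i) {lo hi : ℝ}
    {s₀ : ℕ → ι × ℝ × ℝ} (hs₀ : Feasible w n lo hi s₀) :
    ∃ s, Feasible w n lo hi s ∧ welfare w f lam n s₀ ≤ welfare w f lam n s ∧
      LocallyOptimal w rk lam n lo hi s := by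
  have cworth : ∀ i j, Continuous fun s : ℕ → ι × ℝ × ℝ => worth w (s i) j := fun i j => by
    unfold worth
    have : Continuous fun s : ℕ → ι × ℝ × ℝ => (s i).1 := (continuous_apply i).fst
    exact ((continuous_apply i).snd.fst).mul ((hwc j).comp this)
  have cprice : ∀ i, Continuous fun s : ℕ → ι × ℝ × ℝ => (s i).2.2 := fun i =>
    (continuous_apply i).snd.snd
  have cpay : ∀ i j, Continuous fun s : ℕ → ι × ℝ × ℝ => payoff w (s i) j := fun i j =>
    (cworth i j).sub (cprice i)
  have cwel : Continuous (welfare w f lam n) :=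
    continuous_finsetSum _ fun i _ => ((continuous_const.mul (cpay i i)).add
      (cprice i)).const_mul _ 
  have cP : Continuous fun s : ℕ → ι × ℝ × ℝ => ∑ i ∈ Finset.range n, (s i).2.2 :=
    continuous_finsetSum _ fun i _ => cprice i
  have cR : Continuous fun s : ℕ → ι × ℝ × ℝ => ∑ i ∈ Finset.range n, rk (s i).1 :=
    continuous_finsetSum _ fun i _ => hrk.comp (continuous_apply i).fst
  have hcomp : IsCompact {s | Feasible w n lo hi s} := by
    have hbox : IsCompact (Set.pi univ fun _ : ℕ =>
        (univ : Set ι) ×ˢ (Icc (0 : ℝ) 1 ×ˢ Icc lo hi)) :=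
      isCompact_univ_pi fun _ => isCompact_univ.prod (isCompact_Icc.prod isCompact_Icc)
    have : {s | Feasible w n lo hi s} = (Set.pi univ fun _ : ℕ =>
        (univ : Set ι) ×ˢ (Icc (0 : ℝ) 1 ×ˢ Icc lo hi)) ∩
        ((⋂ i, ⋂ j, ⋂ (_ : i < j), ⋂ (_ : j < n), {s | payoff w (s i) j ≤ payoff w (s j) j}) ∩
          ⋂ i, ⋂ (_ : i < n), {s | 0 ≤ payoff w (s i) i}) := by
      ext s
      simp only [mem_ofPred_eq, mem_inter_iff, mem_pi, mem_univ, true_implies, mem_prod, true_and,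
        mem_iInter]
      exact ⟨fun h => ⟨fun i => ⟨h.prob i, h.price i⟩, h.ic, h.ir⟩,
        fun h => ⟨fun i => (h.1 i).1, fun i => (h.1 i).2, h.2.1, h.2.2⟩⟩
    rw [this]
    refine hbox.inter_right (IsClosed.inter ?_ ?_)
    · exact isClosed_iInter fun i => isClosed_iInter fun j => isClosed_iInter fun _ =>
        isClosed_iInter fun _ => isClosed_le (cpay i j) (cpay j j)
    · exact isClosed_iInter fun i => isClosed_iInter fun _ =>
        isClosed_le continuous_const (cpay i i)
  -- Three nested optimizations over compact sets: maximize welfare, then total price among the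
  -- maximizers, then minimize total rank. A change of one option moves each total only through that
  -- type's term.
  obtain ⟨s₁, hs₁, hmax₁⟩ := hcomp.exists_isMaxOn ⟨s₀, hs₀⟩ cwel.continuousOn
  have hcomp₂ := hcomp.inter_right (isClosed_le (continuous_const (y := welfare w f lam n s₁)) cwel)
  obtain ⟨s₂, hs₂, hmax₂⟩ := hcomp₂.exists_isMaxOn ⟨s₁, hs₁, le_refl (welfare w f lam n s₁)⟩ cP.continuousOn
  have hcomp₃ := hcomp₂.inter_right (isClosed_le
    (continuous_const (y := ∑ i ∈ Finset.range n, (s₂ i).2.2)) cP)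
  obtain ⟨s, ⟨⟨hs, hs'⟩, hs''⟩, hmin⟩ := hcomp₃.exists_isMinOn 
    ⟨s₂, hs₂, le_refl (∑ i ∈ Finset.range n, (s₂ i).2.2)⟩ cR.continuousOn
  refine ⟨s, hs, (hmax₁ hs₀).trans hs', fun a ha o ho hp h1 h2 h3 => ?_⟩
  have hu := hs.update ho hp h1 h2 h3
  have e1 : welfare w f lam n (Function.update s a o) = welfare w f lam n s +
      f a * (contribution w lam o a - contribution w lam (s a) a) := by
    rw [welfare, sum_range_update ha o fun o i => f i * contribution w lam o i, welfare]; ring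
  have e2 := sum_range_update (s := s) ha o fun o _ => o.2.2
  have e3 := sum_range_update (s := s) ha o fun o _ => rk o.1
  simp only [mem_ofPred_eq] at hs' hs''
  have m1 : welfare w f lam n (Function.update s a o) ≤ welfare w f lam n s₁ := hmax₁ hu
  refine ⟨?_, fun hc => ?_⟩
  · have := hf a ha
    by_contra! h
    nlinarith
  · have hu2 : welfare w f lam n s₁ ≤ welfare w f lam n (Function.update s a o) := by
      rw [e1, hc]; linarith
    have m2 : ∑ i ∈ Finset.range n, (Function.update s a o i).2.2
      ≤ ∑ i ∈ Finset.range n, (s₂ i).2.2 := hmax₂ ⟨hu, hu2⟩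
    refine ⟨by linarith, fun hc' => ?_⟩
    have m3 : ∑ i ∈ Finset.range n, rk (s i).1 ≤
        ∑ i ∈ Finset.range n, rk (Function.update s a o i).1 :=
      hmin ⟨⟨hu, hu2⟩, by simp only [mem_ofPred_eq]; linarith⟩
    linarith

/-! ### Monotonicity of ranks and prices at an optimum -/

section LocallyOptimal

variable {lam : ℕ → ℝ} {n : ℕ} {lo hi : ℝ} {s : ℕ → ι × ℝ × ℝ}

/-- In a local optimum no good of lower rank could provide the assigned value. -/
theorem LocallyOptimal.canonical (hw : RankedValues w rk) (hs : Feasible w n lo hi s)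
    (ho : LocallyOptimal w rk lam n lo hi s) {a : ℕ} (ha : a < n) {k : ι}
    (hk : rk k < rk (s a).1) : w k a < worth w (s a) a := by
  by_contra! h
  have hA : 0 ≤ worth w (s a) a := mul_nonneg (hs.prob a).1 (hw.nonneg _ _)
  -- Good `k` with this probability gives type `a` the same value at the same price and higher types
  -- weakly less, so it is feasible and ties in welfare and price but lowers the rank. If `w k a =
  -- 0`, the assigned value is also zero.
  have hval : worth w (s a) a / w k a * w k a = worth w (s a) a := by
    rcases (hw.nonneg k a).eq_or_lt with h0 | h0
    · rw [← h0] at h ⊢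
      linarith
    · field_simp
  set o : ι × ℝ × ℝ := (k, worth w (s a) a / w k a, (s a).2.2) with ho_def
  have hval' : worth w o a = worth w (s a) a := hval
  have hprob : 0 ≤ o.2.1 := div_nonneg hA (hw.nonneg _ _)
  have hpay : payoff w o a = payoff w (s a) a := by simp only [payoff, hval', o]
  have hcon : contribution w lam o a = contribution w lam (s a) a := by
    simp only [contribution, hpay, o]
  have := ho a ha o ⟨hprob, div_le_one_of_le₀ h (hw.nonneg _ _)⟩ (hs.price a)
    (fun i hi => hpay ▸ hs.ic i a hi ha)
    (fun m ham hm => (growth_payoff hw ham.le hprob (hs.prob a).1 hk.le hval'.le hpay.le).trans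
      (hs.ic a m ham hm)) (hpay ▸ hs.ir a ha)
  exact hk.not_ge ((this.2 hcon).2 rfl)

/-- If the good of `i` had the higher rank, then by `canonical` its lottery is worth more to `i`
than the good of `j` for sure. Since it also grows faster, it would be worth more to `j` too,
against the assumption. -/
theorem LocallyOptimal.rank_le (hw : RankedValues w rk) (hs : Feasible w n lo hi s)
    (ho : LocallyOptimal w rk lam n lo hi s) {i j : ℕ} (hij : i < j) (hj : j < n)
    (h : worth w (s i) j ≤ worth w (s j) j) : rk (s i).1 ≤ rk (s j).1 := by
  by_contra! hlt
  have h1 := ho.canonical hw hs (hij.trans hj) hlt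
  have hc := hw.cross _ _ i j hlt.le hij.le
  have hi0 : 0 < w (s i).1 i := by
    refine lt_of_le_of_ne (hw.nonneg _ _) fun h0 => ?_
    have := hw.nonneg (s j).1 i
    simp only [worth, ← h0, mul_zero] at h1
    linarith
  have hij0 : 0 < w (s i).1 j := hi0.trans_le (hw.mono_type _ hij.le)
  have h2 : w (s j).1 j * w (s i).1 i < worth w (s i) j * w (s i).1 i :=
    calc w (s j).1 j * w (s i).1 i ≤ w (s i).1 j * w (s j).1 i := hc
      _ < w (s i).1 j * worth w (s i) i := mul_lt_mul_of_pos_left h1 hij0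
      _ = worth w (s i) j * w (s i).1 i := by unfold worth; ring
  have h3 := lt_of_mul_lt_mul_right h2 hi0.le
  have h4 : worth w (s j) j ≤ w (s j).1 j :=
    mul_le_of_le_one_left (hw.nonneg _ _) (hs.prob j).2
  linarith

theorem LocallyOptimal.rank_ge (hw : RankedValues w rk) (hs : Feasible w n lo hi s)
    (ho : LocallyOptimal w rk lam n lo hi s) {i j : ℕ} (hj : j < n)
    (h : worth w (s j) j < worth w (s i) j) : rk (s j).1 ≤ rk (s i).1 := by
  by_contra! hlt
  have h1 := ho.canonical hw hs hj hlt
  have h4 : worth w (s i) j ≤ w (s i).1 j :=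
    mul_le_of_le_one_left (hw.nonneg _ _) (hs.prob i).2
  linarith

/-- Two adjacent types never pay decreasing prices, if the prices of lower types increase: either
the higher type could be moved to the price of the lower type, or conversely. -/
theorem LocallyOptimal.price_le_succ (hw : RankedValues w rk) (hs : Feasible w n lo hi s)
    (ho : LocallyOptimal w rk lam n lo hi s) (hlam0 : ∀ i < n, 0 ≤ lam i)
    {b : ℕ} (hb : b + 1 < n) (hlam : lam (b + 1) ≤ lam b)
    (hmono : ∀ i < b, (s i).2.2 ≤ (s b).2.2) : (s b).2.2 ≤ (s (b + 1)).2.2 := by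
  by_contra! hlt
  set j := b + 1 with hj
  have hbj : b < j := Nat.lt_succ_self b
  have hbn : b < n := hbj.trans hb
  -- Among the constraints of `j` only the one against `b` matters: increasing prices up to `b` make
  -- `s b` the more valuable and faster growing option, so the preference of `b` for it passes to
  -- `j`.
  have hlow : ∀ i < j, payoff w (s i) j ≤ payoff w (s b) j := fun i hi => by
    rcases (Nat.lt_succ_iff.1 hi).eq_or_lt with rfl | hib
    · exact le_rfl
    · have hic := hs.ic i b hib hbn
      have hval : worth w (s i) b ≤ worth w (s b) b := by
        have := hmono i hib
        unfold payoff at hic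
        linarith
      exact growth_payoff hw hbj.le (hs.prob i).1 (hs.prob b).1
        (ho.rank_le hw hs hib hbn hval) hval hic
  have hU : 0 ≤ payoff w (s b) j := (hs.ir b hbn).trans (by
    have : worth w (s b) b ≤ worth w (s b) j :=
      mul_le_mul_of_nonneg_left (hw.mono_type _ hbj.le) (hs.prob b).1
    unfold payoff; linarith)
  have hicj := hs.ic b j hbj hb
  have hlamj := hlam0 j hb
  rcases le_or_gt (worth w (s b) j) (worth w (s j) j) with hcase | hcase
  · have hrk := ho.rank_le hw hs hbj hb hcase
    rcases le_or_gt (lam j) 1 with hl | hl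
    -- Charge `j` the price of `b`: with weight at most one, the transfer does not lower the
    -- contribution, and it raises the price.
    · set o : ι × ℝ × ℝ := ((s j).1, (s j).2.1, (s b).2.2)
      have hwo : ∀ m, worth w o m = worth w (s j) m := fun _ => rfl
      have hpo : o.2.2 = (s b).2.2 := rfl
      have hge : payoff w (s b) j ≤ payoff w o j := by
        simp only [payoff, hwo, hpo]; linarith
      obtain ⟨h1, h2⟩ := ho j hb o (hs.prob j) (hs.price b)
        (fun i hi => (hlow i hi).trans hge)
        (fun m hjm hm => le_trans (by simp only [payoff, hwo, hpo]; linarith) (hs.ic j m hjm hm))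
        (hU.trans hge)
      have h3 : contribution w lam o j = contribution w lam (s j) j := by
        refine le_antisymm h1 ?_
        simp only [contribution, payoff, hwo, hpo]
        nlinarith
      linarith [(h2 h3).1]
    -- Charge `b` the price of `j`: its weight is at least `lam j > 1`, so the transfer is a strict
    -- gain. Types from `j` upwards still prefer `s j`, which has the same price and is worth more
    -- to them.
    · set o : ι × ℝ × ℝ := ((s b).1, (s b).2.1, (s j).2.2)
      have hwo : ∀ m, worth w o m = worth w (s b) m := fun _ => rfl
      have hpo : o.2.2 = (s j).2.2 := rfl
      have hge : payoff w (s b) b ≤ payoff w o b := by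
        simp only [payoff, hwo, hpo]; linarith
      obtain ⟨h1, -⟩ := ho b hbn o (hs.prob b) (hs.price j)
        (fun i hi => (hs.ic i b hi hbn).trans hge)
        (fun m hbm hm => by
          have hjm : j ≤ m := hbm
          have h1 : payoff w o m ≤ payoff w (s j) m :=
            growth_payoff (o := o) hw hjm (hs.prob b).1 (hs.prob j).1 hrk hcase
              (by simp only [payoff, hwo, hpo]; linarith)
          rcases hjm.eq_or_lt with rfl | hjm
          · exact h1
          · exact h1.trans (hs.ic j m hjm hm))
        ((hs.ir b hbn).trans hge)
      simp only [contribution, payoff, hwo, hpo] at h1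
      nlinarith
  · have hrk := ho.rank_ge hw hs hb hcase
    rcases le_or_gt (lam j * (payoff w (s j) j - payoff w (s b) j))
      ((s b).2.2 - (s j).2.2) with hl | hl
    -- Here the extra price outweighs the weighted loss of `j`, so `j` is given the option of `b`.
    · obtain ⟨h1, h2⟩ := ho j hb (s b) (hs.prob b) (hs.price b) hlow
        (fun m hjm hm => hs.ic b m (hbj.trans hjm) hm) hU
      have h3 : contribution w lam (s b) j = contribution w lam (s j) j := by
        refine le_antisymm h1 ?_
        simp only [contribution]
        linarith
      linarith [(h2 h3).1]
    -- Otherwise `b` is given the option of `j`. As `s b` grows faster, `b` gains at least what `j`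
    -- would have lost, and with a weight at least as large, so the gain exceeds the lost price.
    · have hdiff : worth w (s b) b - worth w (s j) b ≤ worth w (s b) j - worth w (s j) j := by
        rcases le_or_gt (worth w (s j) b) (worth w (s b) b) with hc | hc
        · have := growth hw hbj.le (hs.prob j).1 (hs.prob b).1 hrk hc
          linarith
        · linarith
      have he : payoff w (s j) j - payoff w (s b) j ≤ payoff w (s j) b - payoff w (s b) b := by
        unfold payoff; linarith
      have hge : payoff w (s b) b ≤ payoff w (s j) b := by linarith
      obtain ⟨h1, -⟩ := ho b hbn (s j) (hs.prob j) (hs.price j)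
        (fun i hi => (hs.ic i b hi hbn).trans hge)
        (fun m hbm hm => by
          rcases (show j ≤ m from hbm).eq_or_lt with rfl | hjm
          · exact le_rfl
          · exact hs.ic j m hjm hm)
        ((hs.ir b hbn).trans hge)
      simp only [contribution] at h1
      have := mul_le_mul hlam he (sub_nonneg.2 hicj) (hlamj.trans hlam)
      linarith

theorem LocallyOptimal.price_mono (hw : RankedValues w rk) (hs : Feasible w n lo hi s)
    (ho : LocallyOptimal w rk lam n lo hi s) (hlam0 : ∀ i < n, 0 ≤ lam i)
    (hlam : ∀ i, i + 1 < n → lam (i + 1) ≤ lam i) :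
    ∀ j < n, ∀ i < j, (s i).2.2 ≤ (s j).2.2 := by
  intro j
  induction j with
  | zero => intro _ i hi; omega
  | succ b ih =>
    intro hb i hi
    have hb' := ih (by omega)
    have := ho.price_le_succ hw hs hlam0 hb (hlam b hb) hb'
    rcases (Nat.lt_succ_iff.1 hi).eq_or_lt with rfl | h
    · exact this
    · exact (hb' i h).trans this

theorem LocallyOptimal.worth_le (hw : RankedValues w rk) (hs : Feasible w n lo hi s)
    (ho : LocallyOptimal w rk lam n lo hi s) (hlam0 : ∀ i < n, 0 ≤ lam i)
    (hlam : ∀ i, i + 1 < n → lam (i + 1) ≤ lam i) {i j : ℕ} (hij : i < j) (hj : j < n) :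
    worth w (s i) j ≤ worth w (s j) j := by
  have h1 := ho.price_mono hw hs hlam0 hlam j hj i hij
  have h2 := hs.ic i j hij hj
  unfold payoff at h2
  linarith

end LocallyOptimal

end FiniteScreening

/-! ### Decomposition of lotteries and virtual surplus -/

namespace FiniteScreening

variable {ι : Type*} {w : ι → ℕ → ℝ} {rk : ι → ℝ}

/-- A convex combination of finitely many increasing sequences of goods that gives each type `i`
goods below `k i` whose mean value is the prescribed `A i`. -/
theorem exists_increasing_lottery (hw : RankedValues w rk) {bot : ι} (hbot : ∀ i, w bot i = 0)
    (hbot' : ∀ k, rk bot ≤ rk k) {n : ℕ} {k : ℕ → ι} {ρ : ℕ → ℝ} (hρ : ∀ i, ρ i ∈ Icc (0 : ℝ) 1)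
    (hk : ∀ i, i + 1 < n → rk (k i) ≤ rk (k (i + 1)))
    (hval : ∀ i, i + 1 < n → ρ i * w (k i) (i + 1) ≤ ρ (i + 1) * w (k (i + 1)) (i + 1)) :
    ∀ m ≤ n, ∃ (Ω : Type) (_ : Fintype Ω) (c : Ω → ℝ) (z : Ω → ℕ → ι),
      (∀ ω, 0 ≤ c ω) ∧ ∑ ω, c ω = 1 ∧ (∀ ω, Monotone fun i => rk (z ω i)) ∧
      (∀ ω i, m ≤ i → z ω i = z ω m) ∧
      (∀ i < m, (∀ ω, rk (z ω i) ≤ rk (k i)) ∧ ∑ ω, c ω * w (z ω i) i = ρ i * w (k i) i) ∧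
      (m < n → (∀ ω, rk (z ω m) ≤ rk (k m)) ∧ ∑ ω, c ω * w (z ω m) m ≤ ρ m * w (k m) m) := by
  -- The invariant freezes all paths from `m` on. Means are exact before `m`; at `m` the frozen
  -- goods have at most the prescribed mean, which leaves room for an upgrade.
  intro m
  induction m with
  | zero =>
    intro _
    refine ⟨Unit, inferInstance, fun _ => 1, fun _ _ => bot, by simp, by simp,
      fun _ => monotone_const, by simp, by simp, fun _ => ⟨fun _ => hbot' _, ?_⟩⟩
    simpa [hbot] using mul_nonneg (hρ 0).1 (hw.nonneg _ _)
  | succ m ih =>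
    intro hm
    obtain ⟨Ω, _, c, z, hc0, hc1, hz, hconst, hpast, hnow⟩ := ih (by omega)
    obtain ⟨hzk, hle⟩ := hnow (by omega)
    have hρk : ρ m * w (k m) m ≤ w (k m) m :=
      mul_le_of_le_one_left (hw.nonneg _ _) (hρ m).2
    -- Each path is split: with weight `1 - θ` it keeps its good, with weight `θ` it switches to `k
    -- m` from `m` on. The weight `θ` is chosen to hit the prescribed mean at `m`.
    obtain ⟨θ, hθ0, hθ1, hθ⟩ : ∃ θ : ℝ, 0 ≤ θ ∧ θ ≤ 1 ∧
        (1 - θ) * ∑ ω, c ω * w (z ω m) m + θ * w (k m) m = ρ m * w (k m) m := by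
      rcases (hle.trans hρk).eq_or_lt with h | h
      · exact ⟨0, le_rfl, zero_le_one, by linarith⟩
      · have hpos : 0 < w (k m) m - ∑ ω, c ω * w (z ω m) m := sub_pos.2 h
        refine ⟨(ρ m * w (k m) m - ∑ ω, c ω * w (z ω m) m) / (w (k m) m - ∑ ω, c ω * w (z ω m) m),
          div_nonneg (by linarith) hpos.le, div_le_one_of_le₀ (by linarith) hpos.le, ?_⟩
        field_simp
        ring
    let z' : Ω ⊕ Ω → ℕ → ι := Sum.elim z fun ω i => if i < m then z ω i else k m
    let c' : Ω ⊕ Ω → ℝ := Sum.elim (fun ω => (1 - θ) * c ω) fun ω => θ * c ω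
    have hsum : ∀ g : Ω ⊕ Ω → ℝ, ∑ ω, c' ω * g ω =
        (1 - θ) * ∑ ω, c ω * g (Sum.inl ω) + θ * ∑ ω, c ω * g (Sum.inr ω) := fun g => by
      simp only [Fintype.sum_sum_type, c', Sum.elim_inl, Sum.elim_inr, Finset.mul_sum, mul_assoc]
    have hc'0 : ∀ ω, 0 ≤ c' ω := by
      rintro (ω | ω)
      · exact mul_nonneg (by linarith) (hc0 ω)
      · exact mul_nonneg hθ0 (hc0 ω)
    have hz'm : ∀ ω, rk (z' ω m) ≤ rk (k m) := by
      rintro (ω | ω)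
      · exact hzk ω
      · simp [z']
    have hE : ∑ ω, c' ω * w (z' ω m) m = ρ m * w (k m) m := by
      rw [hsum, ← hθ]
      simp [z', ← Finset.sum_mul, hc1]
    have hz'const : ∀ ω i, m ≤ i → z' ω i = z' ω m := by
      rintro (ω | ω) i hi
      · exact hconst ω i hi
      · simp [z', hi.not_gt]
    refine ⟨Ω ⊕ Ω, inferInstance, c', z', hc'0, ?_, ?_, ?_, ?_, ?_⟩
    · have := hsum fun _ => 1
      simp only [mul_one, hc1] at this
      rw [this]; ring
    · rintro (ω | ω)
      · exact hz ω
      · intro i j hij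
        by_cases hi : i < m
        · by_cases hj : j < m
          · simpa [z', hi, hj] using hz ω hij
          · simpa [z', hi, hj] using (hz ω hi.le).trans (hzk ω)
        · have hj : ¬ j < m := by omega
          simp [z', hi, hj]
    · intro ω i hi
      rw [hz'const ω i (by omega), hz'const ω (m + 1) (by omega)]
    · intro i hi
      rcases (Nat.lt_succ_iff.1 hi).eq_or_lt with rfl | him
      · exact ⟨hz'm, hE⟩
      · refine ⟨?_, ?_⟩
        · rintro (ω | ω)
          · exact (hpast i him).1 ω
          · simpa [z', him] using (hpast i him).1 ω
        · rw [hsum]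
          simp only [z', him, Sum.elim_inl, Sum.elim_inr, if_true, (hpast i him).2]
          ring
    · intro hm1
      have hzeq : ∀ ω, z' ω (m + 1) = z' ω m := fun ω => hz'const ω (m + 1) (by omega)
      simp only [hzeq]
      refine ⟨fun ω => (hz'm ω).trans (hk m hm1), le_trans ?_ (hval m hm1)⟩
      -- All carried goods rank below `k m` and so grow more slowly; their mean at `m + 1` is at
      -- most the value there of the lottery for `m`, hence of that for `m + 1`.
      rcases (hw.nonneg (k m) m).eq_or_lt with h0 | h0
      · have : ∀ ω, w (z' ω m) (m + 1) = 0 := fun ω => by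
          refine hw.eq_zero _ m _ (le_antisymm ?_ (hw.nonneg _ _))
          exact h0 ▸ hw.mono_rank _ _ (hz'm ω) m
        simp only [this, mul_zero, Finset.sum_const_zero]
        exact mul_nonneg (hρ m).1 (hw.nonneg _ _)
      · refine le_of_mul_le_mul_right ?_ h0
        calc (∑ ω, c' ω * w (z' ω m) (m + 1)) * w (k m) m
            = ∑ ω, c' ω * (w (z' ω m) (m + 1) * w (k m) m) := by
              rw [Finset.sum_mul]; exact Finset.sum_congr rfl fun ω _ => by ring
          _ ≤ ∑ ω, c' ω * (w (k m) (m + 1) * w (z' ω m) m) :=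
              Finset.sum_le_sum fun ω _ => mul_le_mul_of_nonneg_left
                (hw.cross _ _ _ _ (hz'm ω) (Nat.le_succ m)) (hc'0 ω)
          _ = w (k m) (m + 1) * ∑ ω, c' ω * w (z' ω m) m := by
              rw [Finset.mul_sum]; exact Finset.sum_congr rfl fun ω _ => by ring
          _ = ρ m * w (k m) (m + 1) * w (k m) m := by rw [hE]; ring

/-- Summation by parts. The last tail is empty, so the value of `U n` is immaterial. -/
theorem sum_mul_eq_sum_tail (g U : ℕ → ℝ) (n : ℕ) :
    ∑ i ∈ Finset.range n, g i * U i = (∑ i ∈ Finset.range n, g i) * U 0 +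
      ∑ i ∈ Finset.range n, (∑ j ∈ Finset.Ico (i + 1) n, g j) * (U (i + 1) - U i) := by
  induction n with
  | zero => simp
  | succ n ih =>
    rw [Finset.sum_range_succ, ih, Finset.sum_range_succ, Finset.sum_range_succ _ n]
    have h : ∀ i ∈ Finset.range n, (∑ j ∈ Finset.Ico (i + 1) (n + 1), g j) * (U (i + 1) - U i) =
        (∑ j ∈ Finset.Ico (i + 1) n, g j) * (U (i + 1) - U i) + g n * (U (i + 1) - U i) :=
      fun i hi => by
        rw [Finset.sum_Ico_succ_top (by have := Finset.mem_range.1 hi; omega), add_mul]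
    rw [Finset.sum_congr rfl h, Finset.sum_add_distrib, ← Finset.mul_sum, Finset.sum_range_sub]
    simp
    ring

/-- The terms change sign at most once, from negative to positive, and their total is nonnegative.
This is where the bound on the mean weight enters: it makes raising everyone's rents costly. -/
theorem tail_nonneg {f lam : ℕ → ℝ} {n : ℕ} (hf : ∀ i < n, 0 < f i)
    (hlam : ∀ i j, i ≤ j → j < n → lam j ≤ lam i)
    (hmean : ∑ i ∈ Finset.range n, f i * lam i ≤ ∑ i ∈ Finset.range n, f i) (i : ℕ) :
    0 ≤ ∑ j ∈ Finset.Ico i n, (1 - lam j) * f j := by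
  rcases le_or_gt n i with hn | hn
  · simp [Finset.Ico_eq_empty_of_le hn]
  rcases le_or_gt (lam i) 1 with h | h
  · refine Finset.sum_nonneg fun j hj => ?_
    rw [Finset.mem_Ico] at hj
    exact mul_nonneg (by linarith [hlam i j hj.1 hj.2]) (hf j hj.2).le
  · have hsplit := Finset.sum_range_add_sum_Ico (fun j => (1 - lam j) * f j) hn.le
    have hneg : ∑ j ∈ Finset.range i, (1 - lam j) * f j ≤ 0 := by
      refine Finset.sum_nonpos fun j hj => ?_
      rw [Finset.mem_range] at hj
      exact mul_nonpos_of_nonpos_of_nonneg (by linarith [hlam j i hj.le hn]) (hf j (hj.trans hn)).le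
    have htot : ∑ j ∈ Finset.range n, (1 - lam j) * f j =
        ∑ i ∈ Finset.range n, f i - ∑ i ∈ Finset.range n, f i * lam i := by
      rw [← Finset.sum_sub_distrib]
      exact Finset.sum_congr rfl fun _ _ => by ring
    linarith

/-- The payoffs that leave no rents in an increasing assignment of goods. -/
def rent (w : ι → ℕ → ℝ) (z : ℕ → ι) (i : ℕ) : ℝ :=
  ∑ m ∈ Finset.range i, (w (z m) (m + 1) - w (z m) m)

theorem rent_succ_sub (w : ι → ℕ → ℝ) (z : ℕ → ι) (i : ℕ) :
    rent w z (i + 1) - rent w z i = w (z i) (i + 1) - w (z i) i := by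
  rw [rent, rent, Finset.sum_range_succ, add_sub_cancel_left]

/-- With finitely many types, increasing assignments of goods are as good as any assignment of
lotteries from which no type prefers the lottery of a lower type. -/
theorem exists_increasing [TopologicalSpace ι] [CompactSpace ι] (hw : RankedValues w rk)
    (hwc : ∀ i, Continuous (w · i)) (hrk : Continuous rk) {bot : ι} (hbot : ∀ i, w bot i = 0)
    (hbot' : ∀ k, rk bot ≤ rk k) {f lam : ℕ → ℝ} {n : ℕ} (hf : ∀ i < n, 0 < f i)
    (hlam0 : ∀ i < n, 0 ≤ lam i) (hlam : ∀ i j, i ≤ j → j < n → lam j ≤ lam i)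
    (hmean : ∑ i ∈ Finset.range n, f i * lam i ≤ ∑ i ∈ Finset.range n, f i) {lo hi : ℝ}
    {s₀ : ℕ → ι × ℝ × ℝ} (hs₀ : Feasible w n lo hi s₀) :
    ∃ z : ℕ → ι, (Monotone fun i => rk (z i)) ∧ welfare w f lam n s₀ ≤
      ∑ i ∈ Finset.range n, f i * (lam i * rent w z i + (w (z i) i - rent w z i)) := by
  obtain ⟨s, hs, hle, ho⟩ := exists_locallyOptimal (lam := lam) hwc hrk hf hs₀
  have hlam' : ∀ i, i + 1 < n → lam (i + 1) ≤ lam i := fun i hi => hlam i _ (Nat.le_succ i) hi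
  have hval : ∀ i, i + 1 < n → worth w (s i) (i + 1) ≤ worth w (s (i + 1)) (i + 1) :=
    fun i hi => ho.worth_le hw hs hlam0 hlam' (Nat.lt_succ_self i) hi
  obtain ⟨Ω, _, c, z, hc0, hc1, hz, -, hE, -⟩ := exists_increasing_lottery hw hbot hbot'
    (n := n) (k := fun i => (s i).1) (ρ := fun i => (s i).2.1) hs.prob
    (fun i hi => ho.rank_le hw hs (Nat.lt_succ_self i) hi (hval i hi)) hval n le_rfl
  let H : ℕ → ℝ := fun i => ∑ j ∈ Finset.Ico i n, (1 - lam j) * f j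
  have hH : ∀ i, 0 ≤ H i := tail_nonneg hf hlam hmean
  -- Virtual surplus: the value to type `i` net of the rents that the good leaves to all higher
  -- types. Divided by `w k i`, it decreases in the rank.
  let ψ : ι → ℕ → ℝ := fun k i => f i * w k i - H (i + 1) * (w k (i + 1) - w k i)
  have hψ : ∀ k l i, rk k ≤ rk l → i < n → w k i * ψ l i ≤ w l i * ψ k i := fun k l i hkl hi => by
    have := mul_le_mul_of_nonneg_left (hw.cross k l i (i + 1) hkl (Nat.le_succ i)) (hH (i + 1))
    simp only [ψ]
    nlinarith
  -- The adjacent constraints bound increments of payoffs from below, and participation bounds the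
  -- lowest payoff; both enter welfare with a nonpositive sign.
  have hupper : welfare w f lam n s ≤ ∑ i ∈ Finset.range n, (s i).2.1 * ψ (s i).1 i := by
    have e1 : welfare w f lam n s = ∑ i ∈ Finset.range n, f i * worth w (s i) i -
        ∑ i ∈ Finset.range n, ((1 - lam i) * f i) * payoff w (s i) i := by
      rw [← Finset.sum_sub_distrib]
      exact Finset.sum_congr rfl fun i _ => by simp only [contribution, payoff]; ring
    have e2 : ∑ i ∈ Finset.range n, (s i).2.1 * ψ (s i).1 i =
        ∑ i ∈ Finset.range n, f i * worth w (s i) i - ∑ i ∈ Finset.range n,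
          H (i + 1) * (worth w (s i) (i + 1) - worth w (s i) i) := by
      rw [← Finset.sum_sub_distrib]
      exact Finset.sum_congr rfl fun i _ => by simp only [ψ, worth]; ring
    have e3 := sum_mul_eq_sum_tail (fun i => (1 - lam i) * f i) (fun i => payoff w (s i) i) n
    rw [e1, e2, e3]
    have h0 : 0 ≤ (∑ i ∈ Finset.range n, (1 - lam i) * f i) * payoff w (s 0) 0 := by
      rcases Nat.eq_zero_or_pos n with rfl | hn
      · simp
      · have := hH 0
        simp only [H, Finset.range_eq_Ico] at this ⊢
        exact mul_nonneg this (hs.ir 0 hn)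
    have h1 : ∑ i ∈ Finset.range n, H (i + 1) * (worth w (s i) (i + 1) - worth w (s i) i) ≤
        ∑ i ∈ Finset.range n, H (i + 1) * (payoff w (s (i + 1)) (i + 1) - payoff w (s i) i) := by
      refine Finset.sum_le_sum fun i hi => ?_
      rcases lt_or_ge (i + 1) n with hin | hin
      · refine mul_le_mul_of_nonneg_left ?_ (hH _)
        have := hs.ic i (i + 1) (Nat.lt_succ_self i) hin
        unfold payoff at *
        linarith
      · simp [H, Finset.Ico_eq_empty_of_le hin]
    simp only [H] at h1 ⊢
    linarith
  -- The mixture provides the same mean value from goods of no higher rank, which yield more virtual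
  -- surplus per unit of value.
  have hlower : ∑ i ∈ Finset.range n, (s i).2.1 * ψ (s i).1 i ≤
      ∑ ω, c ω * ∑ i ∈ Finset.range n, ψ (z ω i) i := by
    simp only [Finset.mul_sum]
    rw [Finset.sum_comm]
    refine Finset.sum_le_sum fun i hi => ?_
    have hin := Finset.mem_range.1 hi
    obtain ⟨hle, heq⟩ := hE i hin
    rcases (hw.nonneg (s i).1 i).eq_or_lt with h0 | h0
    · have hzero : ∀ k, rk k ≤ rk (s i).1 → ψ k i = 0 := fun k hk => by
        have h1 : w k i = 0 := le_antisymm (h0 ▸ hw.mono_rank _ _ hk i) (hw.nonneg _ _)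
        simp [ψ, h1, hw.eq_zero k i (i + 1) h1]
      rw [hzero _ le_rfl, Finset.sum_eq_zero fun ω _ => by rw [hzero _ (hle ω), mul_zero], mul_zero]
    · refine le_of_mul_le_mul_right ?_ h0
      calc (s i).2.1 * ψ (s i).1 i * w (s i).1 i
          = (∑ ω, c ω * w (z ω i) i) * ψ (s i).1 i := by rw [heq]; ring
        _ = ∑ ω, c ω * (w (z ω i) i * ψ (s i).1 i) := by
            rw [Finset.sum_mul]; exact Finset.sum_congr rfl fun ω _ => by ring
        _ ≤ ∑ ω, c ω * (w (s i).1 i * ψ (z ω i) i) :=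
            Finset.sum_le_sum fun ω _ => mul_le_mul_of_nonneg_left (hψ _ _ _ (hle ω) hin) (hc0 ω)
        _ = (∑ ω, c ω * ψ (z ω i) i) * w (s i).1 i := by
            rw [Finset.sum_mul]; exact Finset.sum_congr rfl fun ω _ => by ring
  obtain ⟨ω, hω⟩ : ∃ ω, welfare w f lam n s₀ ≤ ∑ i ∈ Finset.range n, ψ (z ω i) i := by
    by_contra! h
    have h1 : ∑ ω, c ω * ∑ i ∈ Finset.range n, ψ (z ω i) i <
        ∑ ω, c ω * welfare w f lam n s₀ := by
      refine Finset.sum_lt_sum (fun ω _ => mul_le_mul_of_nonneg_left (h ω).le (hc0 ω)) ?_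
      obtain ⟨ω, hω, hpos⟩ : ∃ ω ∈ Finset.univ, 0 < c ω :=
        Finset.exists_lt_of_sum_lt (by simp [hc1])
      exact ⟨ω, hω, mul_lt_mul_of_pos_left (h ω) hpos⟩
    rw [← Finset.sum_mul, hc1, one_mul] at h1
    linarith
  refine ⟨z ω, hz ω, hω.trans (le_of_eq ?_)⟩
  have e3 : ∑ i ∈ Finset.range n, f i * (lam i * rent w (z ω) i + (w (z ω i) i - rent w (z ω) i)) =
      ∑ i ∈ Finset.range n, f i * w (z ω i) i -
        ∑ i ∈ Finset.range n, ((1 - lam i) * f i) * rent w (z ω) i := by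
    rw [← Finset.sum_sub_distrib]
    exact Finset.sum_congr rfl fun i _ => by ring
  have e4 := sum_mul_eq_sum_tail (fun i => (1 - lam i) * f i) (rent w (z ω)) n
  simp only [rent_succ_sub] at e4
  have e5 : rent w (z ω) 0 = 0 := by simp [rent]
  rw [e3, e4, e5, mul_zero, zero_add, ← Finset.sum_sub_distrib]

end FiniteScreening

/-! ### From demand and elasticity curves to values and slopes -/

namespace ScreeningEnv

open MeasureTheory Filter Topology

variable {X : Type*} [MetricSpace X] (E : ScreeningEnv X)

/-- The derivative of the value of an allocation in the type. -/
noncomputable def slope (x : X) (t : ℝ) : ℝ := derivWithin (E.v x) (Icc E.tlo E.thi) t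

theorem tlo_mem : E.tlo ∈ E.types := left_mem_Icc.2 E.tlo_lt_thi.le

theorem thi_mem : E.thi ∈ E.types := right_mem_Icc.2 E.tlo_lt_thi.le

theorem closure_Ioo : closure (Ioo E.tlo E.thi) = E.types := _root_.closure_Ioo E.tlo_lt_thi.ne

theorem continuousOn_slope (x : X) : ContinuousOn (E.slope x) E.types :=
  E.v_t_continuousOn.comp (f := fun t => (x, t)) (by fun_prop) fun t ht => ⟨mem_univ _, ht⟩

theorem continuousOn_v (x : X) : ContinuousOn (E.v x) E.types :=
  (E.v_differentiableOn x).continuousOn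

theorem monotoneOn_v (x : X) : MonotoneOn (E.v x) E.types := by
  by_cases hx : x = E.outside
  · subst hx
    intro s hs t ht _
    rw [E.v_outside s hs, E.v_outside t ht]
  · exact (E.v_strictMonoOn x hx).monotoneOn

theorem v_nonneg (x : X) {t : ℝ} (ht : t ∈ E.types) : 0 ≤ E.v x t := by
  by_cases hx : x = E.outside
  · rw [hx, E.v_outside t ht]
  · exact (E.v_pos x hx t ht).le

theorem slope_nonneg (x : X) (t : ℝ) : 0 ≤ E.slope x t :=
  (E.monotoneOn_v x).derivWithin_nonneg

theorem slope_outside {t : ℝ} (ht : t ∈ E.types) : E.slope E.outside t = 0 := by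
  unfold slope
  rw [derivWithin_congr (f := fun _ => (0 : ℝ)) (fun s hs => E.v_outside s hs) (E.v_outside t ht)]
  simp

theorem hasDerivAt_v (x : X) {t : ℝ} (ht : t ∈ Ioo E.tlo E.thi) :
    HasDerivAt (E.v x) (E.slope x t) t :=
  ((E.v_differentiableOn x t (Ioo_subset_Icc_self ht)).hasDerivWithinAt).hasDerivAt
    (Icc_mem_nhds ht.1 ht.2)

theorem intervalIntegrable_of_types {g : ℝ → ℝ} (hg : ContinuousOn g E.types) {a b : ℝ}
    (ha : a ∈ E.types) (hb : b ∈ E.types) : IntervalIntegrable g volume a b :=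
  (hg.mono (uIcc_subset_Icc ha hb)).intervalIntegrable

theorem integral_slope (x : X) {a b : ℝ} (ha : a ∈ E.types) (hb : b ∈ E.types) (hab : a ≤ b) :
    ∫ t in a..b, E.slope x t = E.v x b - E.v x a :=
  intervalIntegral.integral_eq_sub_of_hasDerivAt_of_le hab
    ((E.continuousOn_v x).mono (Icc_subset_Icc ha.1 hb.2))
    (fun _ ht => E.hasDerivAt_v x ⟨ha.1.trans_lt ht.1, ht.2.trans_le hb.2⟩)
    (E.intervalIntegrable_of_types (E.continuousOn_slope x) ha hb)

/-- Ordering of relative slopes gives ordering of growth rates. -/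
theorem cross_of_slope {a b : X} (ha : a ≠ E.outside)
    (h : ∀ t ∈ Ioo E.tlo E.thi, E.slope a t * E.v b t ≤ E.slope b t * E.v a t)
    {s t : ℝ} (hs : s ∈ E.types) (ht : t ∈ E.types) (hst : s ≤ t) :
    E.v a t * E.v b s ≤ E.v b t * E.v a s := by
  have hmono : MonotoneOn (fun t => E.v b t / E.v a t) E.types := by
    refine monotoneOn_of_deriv_nonneg (convex_Icc _ _)
      ((E.continuousOn_v b).div (E.continuousOn_v a) fun _ ht => (E.v_pos a ha _ ht).ne') ?_ ?_
    · intro t ht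
      rw [interior_Icc] at ht
      exact ((E.hasDerivAt_v b ht).div (E.hasDerivAt_v a ht)
        (E.v_pos a ha t (Ioo_subset_Icc_self ht)).ne').differentiableAt.differentiableWithinAt
    · intro t ht
      rw [interior_Icc] at ht
      have := ((E.hasDerivAt_v b ht).div (E.hasDerivAt_v a ht)
        (E.v_pos a ha t (Ioo_subset_Icc_self ht)).ne').deriv
      rw [show (fun t => E.v b t / E.v a t) = E.v b / E.v a from rfl, this]
      have := h t ht
      exact div_nonneg (by linarith) (sq_nonneg _)
  have := hmono hs ht hst
  simp only at this
  rw [div_le_div_iff₀ (E.v_pos a ha s hs) (E.v_pos a ha t ht)] at this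
  linarith

section Distribution

variable {E} {f : ℝ → ℝ}

theorem IsTypeDensity.cdf_sub (hf : E.IsTypeDensity f) {a b : ℝ} (ha : a ∈ E.types)
    (hb : b ∈ E.types) : E.cdf f b - E.cdf f a = ∫ t in a..b, f t :=
  intervalIntegral.integral_interval_sub_left
    (E.intervalIntegrable_of_types hf.continuousOn E.tlo_mem hb)
    (E.intervalIntegrable_of_types hf.continuousOn E.tlo_mem ha)

theorem IsTypeDensity.integral_pos (hf : E.IsTypeDensity f) {a b : ℝ} (ha : a ∈ E.types)
    (hb : b ∈ E.types) (hab : a < b) : 0 < ∫ t in a..b, f t :=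
  intervalIntegral.intervalIntegral_pos_of_pos_on
    (E.intervalIntegrable_of_types hf.continuousOn ha hb)
    (fun t ht => hf.pos t ⟨ha.1.trans ht.1.le, ht.2.le.trans hb.2⟩) hab

theorem IsTypeDensity.strictMonoOn_cdf (hf : E.IsTypeDensity f) :
    StrictMonoOn (E.cdf f) E.types := fun a ha b hb hab => by
  have := hf.integral_pos ha hb hab
  rw [← hf.cdf_sub ha hb] at this
  linarith

theorem cdf_tlo : E.cdf f E.tlo = 0 := intervalIntegral.integral_same

theorem IsTypeDensity.cdf_thi (hf : E.IsTypeDensity f) : E.cdf f E.thi = 1 := hf.integral_eq_one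

theorem IsTypeDensity.quantile_cdf (hf : E.IsTypeDensity f) {t : ℝ} (ht : t ∈ E.types) :
    E.quantile f (E.cdf f t) = t := by
  have : {s | s ∈ E.types ∧ E.cdf f t ≤ E.cdf f s} = Icc t E.thi := by
    ext s
    constructor
    · rintro ⟨hs, h⟩
      exact ⟨(hf.strictMonoOn_cdf.le_iff_le ht hs).1 h, hs.2⟩
    · rintro ⟨h1, h2⟩
      have hs : s ∈ E.types := ⟨ht.1.trans h1, h2⟩
      exact ⟨hs, (hf.strictMonoOn_cdf.le_iff_le ht hs).2 h1⟩
  rw [quantile, this, csInf_Icc ht.2]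

theorem IsTypeDensity.hasDerivAt_cdf (hf : E.IsTypeDensity f) {t : ℝ}
    (ht : t ∈ Ioo E.tlo E.thi) : HasDerivAt (E.cdf f) (f t) t := by
  have hc : ContinuousOn f (Ioo E.tlo E.thi) := hf.continuousOn.mono Ioo_subset_Icc_self
  exact intervalIntegral.integral_hasDerivAt_right
    (E.intervalIntegrable_of_types hf.continuousOn E.tlo_mem (Ioo_subset_Icc_self ht))
    (hc.stronglyMeasurableAtFilter isOpen_Ioo t ht) (hc.continuousAt (isOpen_Ioo.mem_nhds ht))

theorem IsTypeDensity.cdf_mem (hf : E.IsTypeDensity f) {t : ℝ}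
    (ht : t ∈ Ioo E.tlo E.thi) : E.cdf f t ∈ Ioo (0 : ℝ) 1 := by
  have ht' : t ∈ E.types := Ioo_subset_Icc_self ht
  constructor
  · rw [← cdf_tlo (E := E) (f := f)]; exact hf.strictMonoOn_cdf E.tlo_mem ht' ht.1
  · rw [← hf.cdf_thi]; exact hf.strictMonoOn_cdf ht' E.thi_mem ht.2

theorem IsTypeDensity.cdf_mem_Icc (hf : E.IsTypeDensity f) {t : ℝ}
    (ht : t ∈ E.types) : E.cdf f t ∈ Icc (0 : ℝ) 1 := by
  constructor
  · rw [← cdf_tlo (E := E) (f := f)]; exact hf.strictMonoOn_cdf.monotoneOn E.tlo_mem ht ht.1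
  · rw [← hf.cdf_thi]; exact hf.strictMonoOn_cdf.monotoneOn ht E.thi_mem ht.2

theorem IsTypeDensity.exists_cdf_eq (hf : E.IsTypeDensity f) {y : ℝ} (hy : y ∈ Ioo (0 : ℝ) 1) :
    ∃ t ∈ Ioo E.tlo E.thi, E.cdf f t = y := by
  have hc : ContinuousOn (E.cdf f) E.types := by
    have := intervalIntegral.continuousOn_primitive_interval
      (f := f) (μ := volume) (a := E.tlo) (b := E.thi)
      (by rw [uIcc_of_le E.tlo_lt_thi.le]; exact hf.continuousOn.integrableOn_Icc)
    rwa [uIcc_of_le E.tlo_lt_thi.le] at this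
  have := intermediate_value_Ioo E.tlo_lt_thi.le hc
  rw [cdf_tlo, hf.cdf_thi] at this
  exact this hy

theorem IsTypeDensity.hasDerivAt_quantile (hf : E.IsTypeDensity f) {t : ℝ}
    (ht : t ∈ Ioo E.tlo E.thi) : HasDerivAt (E.quantile f) (f t)⁻¹ (E.cdf f t) := by
  have ht' : t ∈ E.types := Ioo_subset_Icc_self ht
  have hright : ∀ y ∈ Ioo (0 : ℝ) 1, E.quantile f y ∈ Ioo E.tlo E.thi ∧
      E.cdf f (E.quantile f y) = y := fun y hy => by
    obtain ⟨s, hs, rfl⟩ := hf.exists_cdf_eq hy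
    rw [hf.quantile_cdf (Ioo_subset_Icc_self hs)]
    exact ⟨hs, rfl⟩
  have hmem := hf.cdf_mem ht
  have hnhds : Ioo (0 : ℝ) 1 ∈ 𝓝 (E.cdf f t) := isOpen_Ioo.mem_nhds hmem
  have hcont : ContinuousAt (E.quantile f) (E.cdf f t) := by
    refine continuousAt_of_monotoneOn_of_image_mem_nhds (s := Ioo 0 1) ?_ hnhds ?_
    · intro y hy y' hy' hyy'
      rw [← (hright y hy).2, ← (hright y' hy').2] at hyy'
      exact (hf.strictMonoOn_cdf.le_iff_le (Ioo_subset_Icc_self (hright y hy).1)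
        (Ioo_subset_Icc_self (hright y' hy').1)).1 hyy'
    · rw [hf.quantile_cdf ht']
      refine mem_of_superset (isOpen_Ioo.mem_nhds ht) fun s hs => ?_
      exact ⟨E.cdf f s, hf.cdf_mem hs, hf.quantile_cdf (Ioo_subset_Icc_self hs)⟩
  refine HasDerivAt.of_local_left_inverse (f := E.cdf f) hcont ?_ (hf.pos t ht').ne' ?_
  · rw [hf.quantile_cdf ht']
    exact hf.hasDerivAt_cdf ht
  · filter_upwards [hnhds] with y hy using (hright y hy).2

theorem IsTypeDensity.demand_cdf (hf : E.IsTypeDensity f) (x : X) {t : ℝ} (ht : t ∈ E.types) :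
    E.demand f x (1 - E.cdf f t) = E.v x t := by
  rw [demand, sub_sub_cancel, hf.quantile_cdf ht]

/-- Chain rule along `r ↦ F⁻¹(1 - exp r)`. The distribution enters only through a factor independent
of `x`, which cancels when elasticities are compared. -/
theorem IsTypeDensity.elasticity_cdf (hf : E.IsTypeDensity f) {x : X} (hx : x ≠ E.outside) {t : ℝ}
    (ht : t ∈ Ioo E.tlo E.thi) : E.elasticity f x (1 - E.cdf f t) =
      (ENNReal.ofReal (E.slope x t / E.v x t * ((1 - E.cdf f t) / f t)))⁻¹ := by
  have ht' : t ∈ E.types := Ioo_subset_Icc_self ht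
  have hv := E.v_pos x hx t ht'
  have hft := hf.pos t ht'
  have hq : 0 < 1 - E.cdf f t := by linarith [(hf.cdf_mem ht).2]
  have hexp : Real.exp (Real.log (1 - E.cdf f t)) = 1 - E.cdf f t := Real.exp_log hq
  have h1 : HasDerivAt (fun r => 1 - Real.exp r) (-(1 - E.cdf f t))
      (Real.log (1 - E.cdf f t)) := by
    have := (Real.hasDerivAt_exp (Real.log (1 - E.cdf f t))).const_sub 1
    rwa [hexp] at this
  have h2 : HasDerivAt (fun r => E.quantile f (1 - Real.exp r)) ((f t)⁻¹ * -(1 - E.cdf f t))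
      (Real.log (1 - E.cdf f t)) := by
    refine HasDerivAt.comp (h₂ := E.quantile f) _ ?_ h1
    rw [hexp, sub_sub_cancel]
    exact hf.hasDerivAt_quantile ht
  have h3 : HasDerivAt (fun r => E.v x (E.quantile f (1 - Real.exp r)))
      (E.slope x t * ((f t)⁻¹ * -(1 - E.cdf f t))) (Real.log (1 - E.cdf f t)) := by
    refine HasDerivAt.comp (h₂ := E.v x) _ ?_ h2
    rw [hexp, sub_sub_cancel, hf.quantile_cdf ht']
    exact E.hasDerivAt_v x ht
  have hval : E.v x (E.quantile f (1 - Real.exp (Real.log (1 - E.cdf f t)))) = E.v x t := by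
    rw [hexp, sub_sub_cancel, hf.quantile_cdf ht']
  have h4 := h3.log (by rw [hval]; exact hv.ne')
  rw [hval] at h4
  rw [elasticity]
  congr 2
  have : deriv (fun r => Real.log (E.demand f x (Real.exp r))) (Real.log (1 - E.cdf f t)) =
      E.slope x t * ((f t)⁻¹ * -(1 - E.cdf f t)) / E.v x t := h4.deriv
  rw [this, show E.slope x t * ((f t)⁻¹ * -(1 - E.cdf f t)) / E.v x t =
    -(E.slope x t / E.v x t * ((1 - E.cdf f t) / f t)) by field_simp, abs_neg, abs_of_nonneg]
  exact mul_nonneg (div_nonneg (E.slope_nonneg x t) hv.le) (div_nonneg hq.le hft.le)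

theorem SurplusLE.v_le (hf : E.IsTypeDensity f) {x y : X} (h : E.SurplusLE f x y) {t : ℝ}
    (ht : t ∈ E.types) : E.v x t ≤ E.v y t := by
  have hm := hf.cdf_mem_Icc ht
  have := h (1 - E.cdf f t) ⟨by linarith [hm.2], by linarith [hm.1]⟩
  rwa [hf.demand_cdf x ht, hf.demand_cdf y ht] at this

theorem SurplusLT.v_lt (hf : E.IsTypeDensity f) {x y : X} (h : E.SurplusLT f x y) {t : ℝ}
    (ht : t ∈ Ioo E.tlo E.thi) : E.v x t < E.v y t := by
  have hm := hf.cdf_mem ht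
  have := h (1 - E.cdf f t) ⟨by linarith [hm.2], by linarith [hm.1]⟩
  rwa [hf.demand_cdf x (Ioo_subset_Icc_self ht), hf.demand_cdf y (Ioo_subset_Icc_self ht)] at this

theorem ElasticityLE.slope_le (hf : E.IsTypeDensity f) {x y : X} (hx : x ≠ E.outside)
    (hy : y ≠ E.outside) (h : E.ElasticityLE f x y) {t : ℝ} (ht : t ∈ Ioo E.tlo E.thi) :
    E.slope y t * E.v x t ≤ E.slope x t * E.v y t := by
  have hm := hf.cdf_mem ht
  have ht' : t ∈ E.types := Ioo_subset_Icc_self ht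
  have hc : 0 < (1 - E.cdf f t) / f t := div_pos (by linarith [hm.2]) (hf.pos t ht')
  have hvx := E.v_pos x hx t ht'
  have hvy := E.v_pos y hy t ht'
  have := h (1 - E.cdf f t) ⟨by linarith [hm.2], by linarith [hm.1]⟩
  rw [hf.elasticity_cdf hx ht, hf.elasticity_cdf hy ht, ENNReal.inv_le_inv,
    ENNReal.ofReal_le_ofReal_iff (mul_nonneg (div_nonneg (E.slope_nonneg x t) hvx.le) hc.le)] at this
  have := le_of_mul_le_mul_right this hc
  rwa [div_le_div_iff₀ hvy hvx] at this

theorem ElasticityLT.slope_lt (hf : E.IsTypeDensity f) {x y : X} (hx : x ≠ E.outside)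
    (hy : y ≠ E.outside) (h : E.ElasticityLT f x y) {t : ℝ} (ht : t ∈ Ioo E.tlo E.thi) :
    E.slope y t * E.v x t < E.slope x t * E.v y t := by
  have hm := hf.cdf_mem ht
  have ht' : t ∈ E.types := Ioo_subset_Icc_self ht
  have hc : 0 < (1 - E.cdf f t) / f t := div_pos (by linarith [hm.2]) (hf.pos t ht')
  have hvx := E.v_pos x hx t ht'
  have hvy := E.v_pos y hy t ht'
  have := h (1 - E.cdf f t) ⟨by linarith [hm.2], by linarith [hm.1]⟩
  rw [hf.elasticity_cdf hx ht, hf.elasticity_cdf hy ht, ENNReal.inv_lt_inv,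
    ENNReal.ofReal_lt_ofReal_iff_of_nonneg
      (mul_nonneg (div_nonneg (E.slope_nonneg y t) hvy.le) hc.le)] at this
  have := lt_of_mul_lt_mul_right this hc.le
  rwa [div_lt_div_iff₀ hvy hvx] at this

end Distribution

end ScreeningEnv

/-! ### The frontier as a dominant chain -/

namespace ScreeningEnv

open MeasureTheory Filter Topology

variable {X : Type*} [MetricSpace X] (E : ScreeningEnv X)

/-- Projecting the type onto the type space extends the slope to a globally continuous function, so
integrals over types need no side conditions. -/
theorem continuous_slope_projIcc :
    Continuous fun z : X × ℝ => E.slope z.1 (projIcc E.tlo E.thi E.tlo_lt_thi.le z.2) := by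
  have := E.v_t_continuousOn.comp_continuous
    (f := fun z : X × ℝ => (z.1, (projIcc E.tlo E.thi E.tlo_lt_thi.le z.2 : ℝ)))
    (continuous_fst.prodMk (continuous_subtype_val.comp (continuous_projIcc.comp continuous_snd)))
    fun z => ⟨mem_univ _, (projIcc E.tlo E.thi E.tlo_lt_thi.le z.2).2⟩
  exact this

theorem continuous_slope {t : ℝ} (ht : t ∈ E.types) : Continuous fun x => E.slope x t := by
  have := E.continuous_slope_projIcc.comp (Continuous.prodMk_left t)
  simpa [Function.comp_def, projIcc_of_mem E.tlo_lt_thi.le ht] using this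

theorem v_sub_eq_integral (x : X) {s t : ℝ} (hs : s ∈ E.types) (ht : t ∈ E.types) (hst : s ≤ t) :
    E.v x t - E.v x s = ∫ r in s..t, E.slope x (projIcc E.tlo E.thi E.tlo_lt_thi.le r) := by
  rw [← E.integral_slope x hs ht hst]
  refine intervalIntegral.integral_congr fun r hr => ?_
  rw [uIcc_of_le hst] at hr
  rw [projIcc_of_mem E.tlo_lt_thi.le (show r ∈ Icc E.tlo E.thi from
    ⟨hs.1.trans hr.1, hr.2.trans ht.2⟩)]

theorem continuous_v_sub {s t : ℝ} (hs : s ∈ E.types) (ht : t ∈ E.types) (hst : s ≤ t) :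
    Continuous fun x => E.v x t - E.v x s := by
  simp only [E.v_sub_eq_integral _ hs ht hst]
  exact intervalIntegral.continuous_parametric_intervalIntegral_of_continuous'
    E.continuous_slope_projIcc s t

theorem exists_slope_le [CompactSpace X] : ∃ L, 0 ≤ L ∧ ∀ x, ∀ t ∈ E.types, E.slope x t ≤ L := by
  obtain ⟨L, hL⟩ := ((isCompact_univ (X := X)).prod (isCompact_Icc (a := E.tlo) (b := E.thi))
    ).bddAbove_image E.v_t_continuousOn
  have h : ∀ x, ∀ t ∈ E.types, E.slope x t ≤ L := fun x t ht =>
    hL ⟨(x, t), ⟨mem_univ _, ht⟩, rfl⟩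
  exact ⟨L, (E.slope_nonneg E.outside E.tlo).trans (h _ _ E.tlo_mem), h⟩

/-- The increase of the value of an allocation over the type space. -/
def rank (x : X) : ℝ := E.v x E.thi - E.v x E.tlo

/-- Joint continuity of `v_t` controls increments of `v` but not its level, which may jump in the
allocation. This is why the chain is indexed by an increment. -/
theorem continuous_rank : Continuous E.rank := E.continuous_v_sub E.tlo_mem E.thi_mem E.tlo_lt_thi.le

theorem rank_outside : E.rank E.outside = 0 := by
  rw [rank, E.v_outside _ E.thi_mem, E.v_outside _ E.tlo_mem, sub_zero]

theorem rank_nonneg (x : X) : 0 ≤ E.rank x :=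
  sub_nonneg.2 (E.monotoneOn_v x E.tlo_mem E.thi_mem E.tlo_lt_thi.le)

theorem rank_pos {x : X} (hx : x ≠ E.outside) : 0 < E.rank x :=
  sub_pos.2 (E.v_strictMonoOn x hx E.tlo_mem E.thi_mem E.tlo_lt_thi)

/-- A compact menu containing the outside option on which the rank orders allocations by value,
rate of growth of the value, and slope, and which dominates all allocations. -/
structure IsDominantChain (Z : Set X) : Prop where
  isCompact : IsCompact Z
  outside_mem : E.outside ∈ Z
  rank_injOn : InjOn E.rank Z
  v_le : ∀ y ∈ Z, ∀ y' ∈ Z, E.rank y ≤ E.rank y' → ∀ t ∈ E.types, E.v y t ≤ E.v y' t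
  slope_le : ∀ y ∈ Z, ∀ y' ∈ Z, E.rank y ≤ E.rank y' → ∀ t ∈ E.types, E.slope y t ≤ E.slope y' t
  cross : ∀ y ∈ Z, ∀ y' ∈ Z, E.rank y ≤ E.rank y' → ∀ s ∈ E.types, ∀ t ∈ E.types, s ≤ t →
    E.v y t * E.v y' s ≤ E.v y' t * E.v y s
  continuousOn_v : ∀ t ∈ E.types, ContinuousOn (fun y => E.v y t) Z
  dominates : ∀ x, ∃ y ∈ Z, (∀ t ∈ E.types, E.v x t ≤ E.v y t) ∧ ∀ s ∈ E.types, ∀ t ∈ E.types,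
    s ≤ t → E.v y t * E.v x s ≤ E.v x t * E.v y s

/-- Strictly higher value and rate of growth at all interior types. -/
def Below (y y' : X) : Prop :=
  ∀ t ∈ Ioo E.tlo E.thi, E.v y t < E.v y' t ∧ E.slope y t * E.v y' t < E.slope y' t * E.v y t

variable {E}

/-- The slope is the value times its growth rate, and both are higher. These increasing differences
later give incentive compatibility. -/
theorem Below.slope_lt {y y' : X} (h : E.Below y y') {t : ℝ} (ht : t ∈ Ioo E.tlo E.thi) :
    E.slope y t < E.slope y' t := by
  obtain ⟨h1, h2⟩ := h t ht
  have h3 := E.v_nonneg y (Ioo_subset_Icc_self ht)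
  have h4 := E.slope_nonneg y t
  by_contra! h5
  nlinarith

theorem Below.slope_le {y y' : X} (h : E.Below y y') {t : ℝ} (ht : t ∈ E.types) :
    E.slope y t ≤ E.slope y' t := by
  have hcl := E.closure_Ioo
  refine le_on_closure (s := Ioo E.tlo E.thi) (fun t ht => (h.slope_lt ht).le) ?_ ?_ (hcl ▸ ht)
  · exact hcl ▸ E.continuousOn_slope y
  · exact hcl ▸ E.continuousOn_slope y'

theorem Below.v_le {y y' : X} (h : E.Below y y') {t : ℝ} (ht : t ∈ E.types) :
    E.v y t ≤ E.v y' t := by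
  have hcl := E.closure_Ioo
  refine le_on_closure (s := Ioo E.tlo E.thi) (fun t ht => (h t ht).1.le) ?_ ?_ (hcl ▸ ht)
  · exact hcl ▸ E.continuousOn_v y
  · exact hcl ▸ E.continuousOn_v y'

theorem Below.rank_lt {y y' : X} (h : E.Below y y') : E.rank y < E.rank y' := by
  rw [rank, rank, ← E.integral_slope y E.tlo_mem E.thi_mem E.tlo_lt_thi.le,
    ← E.integral_slope y' E.tlo_mem E.thi_mem E.tlo_lt_thi.le, ← sub_pos,
    ← intervalIntegral.integral_sub
      (E.intervalIntegrable_of_types (E.continuousOn_slope y') E.tlo_mem E.thi_mem)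
      (E.intervalIntegrable_of_types (E.continuousOn_slope y) E.tlo_mem E.thi_mem)]
  refine intervalIntegral.intervalIntegral_pos_of_pos_on
    ((E.intervalIntegrable_of_types (E.continuousOn_slope y') E.tlo_mem E.thi_mem).sub
      (E.intervalIntegrable_of_types (E.continuousOn_slope y) E.tlo_mem E.thi_mem))
    (fun t ht => sub_pos.2 (h.slope_lt ht)) E.tlo_lt_thi

theorem exists_slope_pos {x : X} (hx : x ≠ E.outside) : ∃ t ∈ Ioo E.tlo E.thi, 0 < E.slope x t := by
  by_contra! h
  have h1 : ∫ t in E.tlo..E.thi, E.slope x t ≤ 0 := by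
    rw [intervalIntegral.integral_of_le E.tlo_lt_thi.le, integral_Ioc_eq_integral_Ioo]
    exact setIntegral_nonpos measurableSet_Ioo h
  rw [E.integral_slope x E.tlo_mem E.thi_mem E.tlo_lt_thi.le] at h1
  exact (E.rank_pos hx).not_ge h1

theorem IsFrontier.below_or {f : ℝ → ℝ} (hf : E.IsTypeDensity f) {Y : Set X}
    (hY : E.IsFrontier f Y) {y y' : X} (hy : y ∈ Y \ {E.outside}) (hy' : y' ∈ Y \ {E.outside}) :
    y = y' ∨ E.Below y y' ∨ E.Below y' y := by
  obtain ⟨S, e, he, hS⟩ := hY.ordered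
  have key : ∀ s ∈ S, ∀ s' ∈ S, s < s' → E.Below (e s) (e s') := fun s hs s' hs' hlt t ht => by
    obtain ⟨h1, h2⟩ := hS s hs s' hs' hlt
    have hne : ∀ r ∈ S, e r ≠ E.outside := fun r hr => (he ▸ mem_image_of_mem e hr : e r ∈ Y \ {E.outside}).2
    exact ⟨h1.v_lt hf ht, h2.slope_lt hf (hne s' hs') (hne s hs) ht⟩
  rw [← he] at hy hy'
  obtain ⟨s, hs, rfl⟩ := hy
  obtain ⟨s', hs', rfl⟩ := hy'
  rcases lt_trichotomy s s' with h | rfl | h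
  · exact Or.inr (Or.inl (key s hs s' hs' h))
  · exact Or.inl rfl
  · exact Or.inr (Or.inr (key s' hs' s hs h))

theorem IsFrontier.eq_or_below {f : ℝ → ℝ} (hf : E.IsTypeDensity f) {Y : Set X}
    (hY : E.IsFrontier f Y) {y y' : X} (hy : y ∈ insert E.outside Y)
    (hy' : y' ∈ insert E.outside Y) (h : E.rank y ≤ E.rank y') :
    y = y' ∨ y = E.outside ∨ (y ≠ E.outside ∧ y' ≠ E.outside ∧ E.Below y y') := by
  by_cases h0 : y = E.outside
  · exact Or.inr (Or.inl h0)
  have h0' : y' ≠ E.outside := fun h' => by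
    rw [h', E.rank_outside] at h
    exact (E.rank_pos h0).not_ge h
  rcases hY.below_or hf ⟨hy.resolve_left h0, h0⟩ ⟨hy'.resolve_left h0', h0'⟩ with h1 | h1 | h1
  · exact Or.inl h1
  · exact Or.inr (Or.inr ⟨h0, h0', h1⟩)
  · exact absurd h1.rank_lt h.not_gt

/-- Value and growth rate are ordered the same way, so `v y t` lies between `v y₀ t` and the value
that slope `slope y t` would imply at the growth rate of `y₀`. The latter is continuous in `y`,
which squeezes the level. -/
theorem IsFrontier.abs_v_sub_le {f : ℝ → ℝ} (hf : E.IsTypeDensity f) {Y : Set X}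
    (hY : E.IsFrontier f Y) {y y₀ : X} (hy : y ∈ insert E.outside Y)
    (hy₀ : y₀ ∈ insert E.outside Y) {t : ℝ} (ht : t ∈ Ioo E.tlo E.thi) (hpos : 0 < E.slope y₀ t) :
    |E.v y t - E.v y₀ t| ≤ |E.v y₀ t / E.slope y₀ t * E.slope y t - E.v y₀ t| := by
  have ht' : t ∈ E.types := Ioo_subset_Icc_self ht
  have hself : E.v y₀ t / E.slope y₀ t * E.slope y₀ t = E.v y₀ t := by field_simp
  have hout : ∀ y, y = E.outside →
      |E.v y t - E.v y₀ t| ≤ |E.v y₀ t / E.slope y₀ t * E.slope y t - E.v y₀ t| := by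
    rintro _ rfl
    rw [E.v_outside t ht', E.slope_outside ht', mul_zero]
  rcases le_total (E.rank y) (E.rank y₀) with h | h
  · rcases hY.eq_or_below hf hy hy₀ h with rfl | h0 | ⟨-, -, hb⟩
    · simp
    · exact hout y h0
    · obtain ⟨h1, h2⟩ := hb t ht
      have h3 : E.v y₀ t / E.slope y₀ t * E.slope y t ≤ E.v y t := by
        rw [div_mul_eq_mul_div, div_le_iff₀ hpos]; linarith
      rw [abs_of_nonpos (by linarith), abs_of_nonpos (by linarith)]
      linarith
  · rcases hY.eq_or_below hf hy₀ hy h with rfl | h0 | ⟨-, -, hb⟩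
    · simp
    · rw [h0, E.slope_outside ht'] at hpos
      exact absurd hpos (lt_irrefl _)
    · obtain ⟨h1, h2⟩ := hb t ht
      have h3 : E.v y t ≤ E.v y₀ t / E.slope y₀ t * E.slope y t := by
        rw [div_mul_eq_mul_div, le_div_iff₀ hpos]; linarith
      rw [abs_of_nonneg (by linarith), abs_of_nonneg (by linarith)]
      linarith

/-- Values are continuous along a frontier. -/
theorem IsFrontier.continuousOn_v {f : ℝ → ℝ} (hf : E.IsTypeDensity f) {Y : Set X}
    (hY : E.IsFrontier f Y) {t : ℝ} (ht : t ∈ E.types) :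
    ContinuousOn (fun y => E.v y t) (insert E.outside Y) := by
  intro y₀ hy₀
  by_cases h0 : y₀ = E.outside
  · rw [h0]
    exact (E.v_continuousAt_outside t ht).continuousWithinAt
  -- The squeeze needs a positive slope at `y₀`, so it is applied at one such type `r`; continuity
  -- at `t` follows because increments are continuous.
  obtain ⟨r, hr, hpos⟩ := exists_slope_pos h0
  have hr' : r ∈ E.types := Ioo_subset_Icc_self hr
  have h1 : ContinuousWithinAt (fun y => E.v y r) (insert E.outside Y) y₀ := by
    rw [ContinuousWithinAt, tendsto_iff_norm_sub_tendsto_zero]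
    have hlim : Tendsto (fun y => |E.v y₀ r / E.slope y₀ r * E.slope y r - E.v y₀ r|)
        (𝓝[insert E.outside Y] y₀) (𝓝 0) := by
      have hc : Continuous fun y => |E.v y₀ r / E.slope y₀ r * E.slope y r - E.v y₀ r| :=
        ((continuous_const.mul (E.continuous_slope hr')).sub continuous_const).abs
      have := hc.tendsto y₀
      rw [div_mul_cancel₀ _ hpos.ne', sub_self, abs_zero] at this
      exact this.mono_left nhdsWithin_le_nhds
    refine squeeze_zero' (Eventually.of_forall fun _ => norm_nonneg _) ?_ hlim
    filter_upwards [self_mem_nhdsWithin] with y hy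
    exact hY.abs_v_sub_le hf hy hy₀ hr hpos
  rcases le_total r t with h | h
  · exact (h1.add (E.continuous_v_sub hr' ht h).continuousWithinAt).congr
      (fun _ _ => by simp) (by simp)
  · exact (h1.sub (E.continuous_v_sub ht hr' h).continuousWithinAt).congr
      (fun _ _ => by simp) (by simp)

theorem IsFrontier.isDominantChain {f : ℝ → ℝ} (hf : E.IsTypeDensity f) {Y : Set X}
    (hY : E.IsFrontier f Y) : E.IsDominantChain (insert E.outside Y) where
  isCompact := hY.isCompact.insert _
  outside_mem := mem_insert _ _
  rank_injOn y hy y' hy' h := by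
    rcases hY.eq_or_below hf hy hy' h.le with h1 | h1 | ⟨-, -, h1⟩
    · exact h1
    · by_contra h2
      have := E.rank_pos (x := y') fun h3 => h2 (h1.trans h3.symm)
      rw [← h, h1, E.rank_outside] at this
      exact lt_irrefl _ this
    · exact absurd h h1.rank_lt.ne
  v_le y hy y' hy' h t ht := by
    rcases hY.eq_or_below hf hy hy' h with rfl | rfl | ⟨-, -, h1⟩
    · exact le_rfl
    · rw [E.v_outside t ht]; exact E.v_nonneg _ ht
    · exact h1.v_le ht
  slope_le y hy y' hy' h t ht := by
    rcases hY.eq_or_below hf hy hy' h with rfl | rfl | ⟨-, -, h1⟩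
    · exact le_rfl
    · rw [E.slope_outside ht]; exact E.slope_nonneg _ _
    · exact h1.slope_le ht
  cross y hy y' hy' h s hs t ht hst := by
    rcases hY.eq_or_below hf hy hy' h with rfl | rfl | ⟨h0, -, h1⟩
    · exact le_rfl
    · rw [E.v_outside t ht, E.v_outside s hs, mul_zero, zero_mul]
    · exact E.cross_of_slope h0 (fun r hr => (h1 r hr).2.le) hs ht hst
  continuousOn_v _ ht := hY.continuousOn_v hf ht
  dominates x := by
    by_cases hx : x ∈ insert E.outside Y
    · exact ⟨x, hx, fun _ _ => le_rfl, fun _ _ _ _ _ => le_rfl⟩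
    · rw [mem_insert_iff, not_or] at hx
      obtain ⟨y, hy, h1, h2⟩ := hY.dominates x hx.2 hx.1
      exact ⟨y, mem_insert_of_mem _ hy.1, fun t ht => h1.v_le hf ht, fun s hs t ht hst =>
        E.cross_of_slope hy.2 (fun r hr => h2.slope_le hf hx.1 hy.2 hr) hs ht hst⟩

end ScreeningEnv

/-! ### Bounds on mechanisms and envelope payments -/

namespace ScreeningEnv

open MeasureTheory Filter Topology

variable {X : Type*} [MetricSpace X] {E : ScreeningEnv X}

section Mechanism

/-- Compactness of `X` alone does not bound `v`, whose level need not be continuous; the bound comes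
from the chain, where values are continuous and which dominates everything. -/
theorem IsDominantChain.exists_v_le {Z : Set X} (hZ : E.IsDominantChain Z) :
    ∃ C, 0 ≤ C ∧ ∀ x, ∀ t ∈ E.types, E.v x t ≤ C := by
  obtain ⟨C, hC⟩ := hZ.isCompact.bddAbove_image (hZ.continuousOn_v _ E.thi_mem)
  have h : ∀ x, ∀ t ∈ E.types, E.v x t ≤ C := fun x t ht => by
    obtain ⟨y, hy, hxy, -⟩ := hZ.dominates x
    exact (hxy t ht).trans ((E.monotoneOn_v y ht E.thi_mem ht.2).trans (hC ⟨y, hy, rfl⟩))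
  exact ⟨C, (E.v_nonneg E.outside E.tlo_mem).trans (h _ _ E.tlo_mem), h⟩

variable [MeasurableSpace X] {x : ℝ → X} {p : ℝ → ℝ}

theorem IsMechanism.monotoneOn_payoff (h : E.IsMechanism x p) :
    MonotoneOn (fun t => E.v (x t) t - p t) E.types := fun s hs t ht hst => by
  have h1 := h.ic t ht s hs
  have h2 := E.monotoneOn_v (x s) hs ht hst
  simp only
  linarith

theorem IsMechanism.payoff_sub_le (h : E.IsMechanism x p) {C : ℝ}
    (hC : ∀ x, ∀ t ∈ E.types, E.v x t ≤ C) :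
    (E.v (x E.thi) E.thi - p E.thi) - (E.v (x E.tlo) E.tlo - p E.tlo) ≤ C := by
  have h1 := h.ic _ E.tlo_mem _ E.thi_mem
  have h2 := E.v_nonneg (x E.thi) E.tlo_mem
  have h3 := hC (x E.thi) _ E.thi_mem
  linarith

theorem IsMechanism.pay_mem (h : E.IsMechanism x p) {C : ℝ}
    (hC : ∀ x, ∀ t ∈ E.types, E.v x t ≤ C) {t : ℝ} (ht : t ∈ E.types) :
    p t ∈ Icc (-(E.v (x E.thi) E.thi - p E.thi)) C := by
  have h1 := h.ir t ht
  have h2 := h.monotoneOn_payoff ht E.thi_mem ht.2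
  have h3 := hC (x t) t ht
  have h4 := E.v_nonneg (x t) ht
  simp only at h2
  constructor <;> linarith

theorem IsMechanism.intervalIntegrable_pay (h : E.IsMechanism x p) {C : ℝ}
    (hC : ∀ x, ∀ t ∈ E.types, E.v x t ≤ C) : IntervalIntegrable p volume E.tlo E.thi := by
  rw [intervalIntegrable_iff_integrableOn_Icc_of_le E.tlo_lt_thi.le]
  have hm : AEMeasurable p (volume.restrict (Icc E.tlo E.thi)) :=
    aemeasurable_restrict_of_measurable_subtype measurableSet_Icc h.measurable_pay
  refine Integrable.of_bound hm.aestronglyMeasurable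
    (max |-(E.v (x E.thi) E.thi - p E.thi)| |C|) ?_
  filter_upwards [ae_restrict_mem measurableSet_Icc] with t ht
  obtain ⟨h1, h2⟩ := h.pay_mem hC ht
  exact abs_le_max_abs_abs h1 h2

end Mechanism

/-- Assignments of allocations in `Z` to types whose rank increases. -/
structure IsIncreasing (E : ScreeningEnv X) (Z : Set X) (z : ℝ → X) : Prop where
  mem : ∀ t, z t ∈ Z
  mono : Monotone fun t => E.rank (z t)

/-- The payoffs that leave no rents to the lowest type in an increasing assignment. -/
noncomputable def rents (E : ScreeningEnv X) (z : ℝ → X) (t : ℝ) : ℝ :=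
  ∫ s in E.tlo..t, E.slope (z s) (projIcc E.tlo E.thi E.tlo_lt_thi.le s)

/-- The payments that leave no rents to the lowest type in an increasing assignment. -/
noncomputable def payment (E : ScreeningEnv X) (z : ℝ → X) (t : ℝ) : ℝ := E.v (z t) t - E.rents z t

theorem rents_tlo (z : ℝ → X) : E.rents z E.tlo = 0 := intervalIntegral.integral_same

theorem objective_payment (f lam : ℝ → ℝ) (z : ℝ → X) : E.objective f lam z (E.payment z) =
    (∫ t in E.tlo..E.thi, E.rents z t * (lam t * f t)) +
      ∫ t in E.tlo..E.thi, E.payment z t * f t := by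
  simp only [objective, expect, payment, sub_sub_cancel]
  congr 2
  ext t
  ring

section Increasing

variable [MeasurableSpace X] [BorelSpace X] {Z : Set X} {z : ℝ → X}

/-- The rank embeds the compact chain as a closed subset of the line, so measurability can be
checked on the monotone rank. -/
theorem IsIncreasing.measurable (hZ : E.IsDominantChain Z) (hz : E.IsIncreasing Z z) :
    Measurable z := by
  have : CompactSpace Z := isCompact_iff_compactSpace.1 hZ.isCompact
  have hemb : MeasurableEmbedding fun y : Z => E.rank y :=
    ((E.continuous_rank.comp continuous_subtype_val).isClosedEmbedding
      (injOn_iff_injective.1 hZ.rank_injOn)).measurableEmbedding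
  have : Measurable fun t => (⟨z t, hz.mem t⟩ : Z) :=
    hemb.measurable_comp_iff.1 hz.mono.measurable
  exact measurable_subtype_coe.comp this

theorem IsIncreasing.measurable_slope (hZ : E.IsDominantChain Z) (hz : E.IsIncreasing Z z) :
    Measurable fun t => E.slope (z t) (projIcc E.tlo E.thi E.tlo_lt_thi.le t) :=
  E.continuous_slope_projIcc.measurable.comp ((hz.measurable hZ).prodMk measurable_id)

variable [CompactSpace X]

theorem IsIncreasing.intervalIntegrable_slope (hZ : E.IsDominantChain Z)
    (hz : E.IsIncreasing Z z) (a b : ℝ) : IntervalIntegrable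
      (fun t => E.slope (z t) (projIcc E.tlo E.thi E.tlo_lt_thi.le t)) volume a b := by
  obtain ⟨L, hL0, hL⟩ := E.exists_slope_le
  refine (intervalIntegrable_const (c := L)).mono_fun
    (hz.measurable_slope hZ).aestronglyMeasurable (Eventually.of_forall fun t => ?_)
  beta_reduce
  rw [Real.norm_of_nonneg (E.slope_nonneg _ _), Real.norm_of_nonneg hL0]
  exact hL _ _ (projIcc E.tlo E.thi E.tlo_lt_thi.le t).2

theorem IsIncreasing.rents_sub (hZ : E.IsDominantChain Z) (hz : E.IsIncreasing Z z) (s t : ℝ) :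
    E.rents z t - E.rents z s =
      ∫ r in s..t, E.slope (z r) (projIcc E.tlo E.thi E.tlo_lt_thi.le r) :=
  intervalIntegral.integral_interval_sub_left (hz.intervalIntegrable_slope hZ _ _)
    (hz.intervalIntegrable_slope hZ _ _)

/-- Slopes increase along the assignment. This inequality keeps `t` from imitating the lower type
`s`; its counterpart `rents_sub_le` keeps `s` from imitating `t`. -/
theorem IsIncreasing.le_rents_sub (hZ : E.IsDominantChain Z) (hz : E.IsIncreasing Z z) {s t : ℝ}
    (hs : s ∈ E.types) (ht : t ∈ E.types) (hst : s ≤ t) :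
    E.v (z s) t - E.v (z s) s ≤ E.rents z t - E.rents z s := by
  rw [hz.rents_sub hZ, E.v_sub_eq_integral _ hs ht hst]
  refine intervalIntegral.integral_mono_on hst ?_ (hz.intervalIntegrable_slope hZ _ _) ?_
  · exact (E.continuous_slope_projIcc.comp (Continuous.prodMk_right (z s))).intervalIntegrable _ _
  · intro r hr
    exact hZ.slope_le _ (hz.mem _) _ (hz.mem _) (hz.mono hr.1) _
      (projIcc E.tlo E.thi E.tlo_lt_thi.le r).2

theorem IsIncreasing.rents_sub_le (hZ : E.IsDominantChain Z) (hz : E.IsIncreasing Z z) {s t : ℝ}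
    (hs : s ∈ E.types) (ht : t ∈ E.types) (hst : s ≤ t) :
    E.rents z t - E.rents z s ≤ E.v (z t) t - E.v (z t) s := by
  rw [hz.rents_sub hZ, E.v_sub_eq_integral _ hs ht hst]
  refine intervalIntegral.integral_mono_on hst (hz.intervalIntegrable_slope hZ _ _) ?_ ?_
  · exact (E.continuous_slope_projIcc.comp (Continuous.prodMk_right (z t))).intervalIntegrable _ _
  · intro r hr
    exact hZ.slope_le _ (hz.mem _) _ (hz.mem _) (hz.mono hr.2) _
      (projIcc E.tlo E.thi E.tlo_lt_thi.le r).2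

theorem IsIncreasing.monotoneOn_rents (hZ : E.IsDominantChain Z) (hz : E.IsIncreasing Z z) :
    MonotoneOn (E.rents z) E.types := fun s hs t ht hst => by
  have h1 := hz.le_rents_sub hZ hs ht hst
  have h2 := E.monotoneOn_v (z s) hs ht hst
  linarith

theorem IsIncreasing.monotoneOn_payment (hZ : E.IsDominantChain Z) (hz : E.IsIncreasing Z z) :
    MonotoneOn (E.payment z) E.types := fun s hs t ht hst => by
  have h1 := hz.rents_sub_le hZ hs ht hst
  have h2 := hZ.v_le _ (hz.mem s) _ (hz.mem t) (hz.mono hst) s hs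
  unfold payment
  linarith

theorem IsIncreasing.rents_nonneg (hZ : E.IsDominantChain Z) (hz : E.IsIncreasing Z z) {t : ℝ}
    (ht : t ∈ E.types) : 0 ≤ E.rents z t :=
  rents_tlo (E := E) z ▸ hz.monotoneOn_rents hZ E.tlo_mem ht ht.1

theorem IsIncreasing.rents_le (hZ : E.IsDominantChain Z) (hz : E.IsIncreasing Z z) {C : ℝ}
    (hC : ∀ x, ∀ t ∈ E.types, E.v x t ≤ C) {t : ℝ} (ht : t ∈ E.types) : E.rents z t ≤ C := by
  have h1 := hz.rents_sub_le hZ E.tlo_mem ht ht.1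
  have h2 := E.v_nonneg (z t) E.tlo_mem
  have h3 := hC (z t) t ht
  rw [rents_tlo] at h1
  linarith

theorem IsIncreasing.payment_nonneg (hZ : E.IsDominantChain Z) (hz : E.IsIncreasing Z z) {t : ℝ}
    (ht : t ∈ E.types) : 0 ≤ E.payment z t := by
  refine le_trans ?_ (hz.monotoneOn_payment hZ E.tlo_mem ht ht.1)
  rw [payment, rents_tlo, sub_zero]
  exact E.v_nonneg _ E.tlo_mem

theorem IsIncreasing.payment_le (hZ : E.IsDominantChain Z) (hz : E.IsIncreasing Z z) {C : ℝ}
    (hC : ∀ x, ∀ t ∈ E.types, E.v x t ≤ C) {t : ℝ} (ht : t ∈ E.types) : E.payment z t ≤ C := by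
  have h1 := hz.rents_nonneg hZ ht
  have h2 := hC (z t) t ht
  unfold payment
  linarith

/-- Increasing assignments are implemented by the payments that leave no rents. -/
theorem IsIncreasing.isMechanism (hZ : E.IsDominantChain Z) (hz : E.IsIncreasing Z z) :
    E.IsMechanism z (E.payment z) where
  measurable_alloc := (hz.measurable hZ).comp measurable_subtype_coe
  measurable_pay := by
    have : OrdConnected E.types := ordConnected_Icc
    have hm : Monotone (E.types.domRestrict (E.payment z)) := fun s t hst =>
      hz.monotoneOn_payment hZ s.2 t.2 hst
    exact hm.measurable
  ic t ht s hs := by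
    simp only [payment, sub_sub_cancel]
    rcases le_total s t with h | h
    · have := hz.le_rents_sub hZ hs ht h
      linarith
    · have := hz.rents_sub_le hZ ht hs h
      linarith
  ir t ht := by
    simp only [payment, sub_sub_cancel]
    exact hz.rents_nonneg hZ ht

end Increasing

end ScreeningEnv

/-! ### Discretization of the type space -/

namespace ScreeningEnv

open MeasureTheory Filter Topology FiniteScreening

/-- The step function that takes the value `a i` between the `i`-th and the `(i + 1)`-th point. -/
noncomputable def stepFun {α : Type*} (τ : ℕ → ℝ) (N : ℕ) (x₀ : α) (a : ℕ → α) (t : ℝ) : α :=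
  open Classical in
  if ({i ∈ Finset.range N | τ i ≤ t}).card = 0 then x₀ else
    a (({i ∈ Finset.range N | τ i ≤ t}).card - 1)

theorem stepFun_of_lt {α : Type*} {τ : ℕ → ℝ} (hτ : Monotone τ) {N : ℕ} {x₀ : α} {a : ℕ → α} {t : ℝ}
    (ht : t < τ 0) : stepFun τ N x₀ a t = x₀ := by
  classical
  have : ({i ∈ Finset.range N | τ i ≤ t}).card = 0 := by
    rw [Finset.card_eq_zero, Finset.filter_eq_empty_iff]
    intro i _ hi
    exact (hi.trans_lt ht).not_ge (hτ (Nat.zero_le i))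
  rw [stepFun]
  convert if_pos this

theorem stepFun_of_mem {α : Type*} {τ : ℕ → ℝ} (hτ : Monotone τ) {N : ℕ} {x₀ : α} {a : ℕ → α} {t : ℝ} {i : ℕ}
    (hi : i < N) (h1 : τ i ≤ t) (h2 : i + 1 < N → t < τ (i + 1)) :
    stepFun τ N x₀ a t = a i := by
  classical
  have : {i ∈ Finset.range N | τ i ≤ t} = Finset.range (i + 1) := by
    ext j
    simp only [Finset.mem_filter, Finset.mem_range]
    constructor
    · rintro ⟨hj, hjt⟩
      by_contra! hij
      exact ((h2 (by omega)).trans_le (hτ hij)).not_ge hjt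
    · intro hj
      exact ⟨by omega, (hτ (Nat.lt_succ_iff.1 hj)).trans h1⟩
  have hc : ({i ∈ Finset.range N | τ i ≤ t}).card = i + 1 := by rw [this, Finset.card_range]
  have h3 : (if ({i ∈ Finset.range N | τ i ≤ t}).card = 0 then x₀ else
    a (({i ∈ Finset.range N | τ i ≤ t}).card - 1)) = a i := by
    rw [hc]; simp
  rw [stepFun]
  convert h3

variable {X : Type*} [MetricSpace X] {E : ScreeningEnv X}

/-- The points that divide the type space into `N` intervals of equal length. -/
noncomputable def gridPoint (E : ScreeningEnv X) (N i : ℕ) : ℝ :=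
  E.tlo + i * ((E.thi - E.tlo) / N)

theorem gridPoint_zero (N : ℕ) : E.gridPoint N 0 = E.tlo := by simp [gridPoint]

theorem gridPoint_self {N : ℕ} (hN : 0 < N) : E.gridPoint N N = E.thi := by
  have : (N : ℝ) ≠ 0 := by positivity
  unfold gridPoint
  field_simp
  ring

theorem gridPoint_succ (N i : ℕ) :
    E.gridPoint N (i + 1) = E.gridPoint N i + (E.thi - E.tlo) / N := by
  unfold gridPoint
  push_cast
  ring

theorem gridPoint_lt_succ {N : ℕ} (hN : 0 < N) (i : ℕ) :
    E.gridPoint N i < E.gridPoint N (i + 1) := by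
  have : (0 : ℝ) < N := by positivity
  rw [gridPoint_succ, lt_add_iff_pos_right]
  exact div_pos (sub_pos.2 E.tlo_lt_thi) this

theorem monotone_gridPoint {N : ℕ} (hN : 0 < N) : Monotone (E.gridPoint N) :=
  monotone_nat_of_le_succ fun i => (gridPoint_lt_succ hN i).le

theorem gridPoint_mem {N i : ℕ} (hN : 0 < N) (hi : i ≤ N) : E.gridPoint N i ∈ E.types := by
  constructor
  · rw [← gridPoint_zero (E := E) N]
    exact monotone_gridPoint hN (Nat.zero_le i)
  · rw [← gridPoint_self (E := E) hN]
    exact monotone_gridPoint hN hi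

/-- The integral over a cell of the grid. -/
noncomputable def cellIntegral (E : ScreeningEnv X) (N : ℕ) (φ : ℝ → ℝ) (i : ℕ) : ℝ :=
  ∫ t in E.gridPoint N i..E.gridPoint N (i + 1), φ t

theorem sum_cellIntegral {N : ℕ} (hN : 0 < N) {φ : ℝ → ℝ}
    (hφ : IntervalIntegrable φ volume E.tlo E.thi) :
    ∑ i ∈ Finset.range N, E.cellIntegral N φ i = ∫ t in E.tlo..E.thi, φ t := by
  have := intervalIntegral.sum_integral_adjacent_intervals (f := φ) (μ := volume)
    (a := E.gridPoint N) (n := N) fun k hk => hφ.mono_set <| by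
      rw [uIcc_of_le (gridPoint_lt_succ hN k).le, uIcc_of_le E.tlo_lt_thi.le]
      exact Icc_subset_Icc (gridPoint_mem hN hk.le).1 (gridPoint_mem hN hk).2
  rwa [gridPoint_zero, gridPoint_self hN] at this

/-- Error of Riemann sums of monotone functions. -/
theorem abs_integral_sub_sum_le {N : ℕ} (hN : 0 < N) {φ g : ℝ → ℝ} (hφ : ContinuousOn φ E.types)
    {Φ : ℝ} (hΦ : ∀ t ∈ E.types, |φ t| ≤ Φ) (hg : MonotoneOn g E.types) {τ : ℕ → ℝ}
    (hτ : ∀ i < N, τ i ∈ Icc (E.gridPoint N i) (E.gridPoint N (i + 1))) :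
    |(∫ t in E.tlo..E.thi, g t * φ t) - ∑ i ∈ Finset.range N, g (τ i) * E.cellIntegral N φ i| ≤
      Φ * (g E.thi - g E.tlo) * ((E.thi - E.tlo) / N) := by
  have huIcc : uIcc E.tlo E.thi = E.types := uIcc_of_le E.tlo_lt_thi.le
  have hφi : IntervalIntegrable φ volume E.tlo E.thi :=
    E.intervalIntegrable_of_types hφ E.tlo_mem E.thi_mem
  have hgφ : IntervalIntegrable (fun t => g t * φ t) volume E.tlo E.thi :=
    (MonotoneOn.intervalIntegrable (huIcc ▸ hg)).mul_continuousOn (huIcc ▸ hφ)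
  have hΦ0 : 0 ≤ Φ := (abs_nonneg _).trans (hΦ _ E.tlo_mem)
  rw [← sum_cellIntegral hN hgφ, ← Finset.sum_sub_distrib]
  refine (Finset.abs_sum_le_sum_abs _ _).trans ?_
  have hcell : ∀ i ∈ Finset.range N,
      |E.cellIntegral N (fun t => g t * φ t) i - g (τ i) * E.cellIntegral N φ i| ≤
        Φ * (g (E.gridPoint N (i + 1)) - g (E.gridPoint N i)) * ((E.thi - E.tlo) / N) := by
    intro i hi
    have hiN := Finset.mem_range.1 hi
    have hlt := gridPoint_lt_succ (E := E) hN i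
    have hm := gridPoint_mem (E := E) hN hiN.le
    have hm' := gridPoint_mem (E := E) hN hiN
    have hsub : uIcc (E.gridPoint N i) (E.gridPoint N (i + 1)) ⊆ uIcc E.tlo E.thi := by
      rw [uIcc_of_le hlt.le, huIcc]
      exact Icc_subset_Icc hm.1 hm'.2
    have hτm : τ i ∈ E.types := Icc_subset_Icc hm.1 hm'.2 (hτ i hiN)
    rw [cellIntegral, cellIntegral, ← intervalIntegral.integral_const_mul,
      ← intervalIntegral.integral_sub (hgφ.mono_set hsub) ((hφi.mono_set hsub).const_mul _)]
    have := intervalIntegral.norm_integral_le_of_norm_le_const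
      (a := E.gridPoint N i) (b := E.gridPoint N (i + 1))
      (f := fun t => g t * φ t - g (τ i) * φ t)
      (C := Φ * (g (E.gridPoint N (i + 1)) - g (E.gridPoint N i))) fun t ht => by
        rw [uIoc_of_le hlt.le] at ht
        have htm : t ∈ E.types := ⟨hm.1.trans ht.1.le, ht.2.trans hm'.2⟩
        rw [← sub_mul, norm_mul, mul_comm]
        refine mul_le_mul (hΦ t htm) ?_ (norm_nonneg _) hΦ0
        have h1 := hg hm htm ht.1.le
        have h2 := hg htm hm' ht.2
        have h3 := hg hm hτm (hτ i hiN).1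
        have h4 := hg hτm hm' (hτ i hiN).2
        rw [Real.norm_eq_abs, abs_le]
        constructor <;> linarith
    rwa [gridPoint_succ, add_sub_cancel_left, abs_of_nonneg
      (div_nonneg (sub_nonneg.2 E.tlo_lt_thi.le) (Nat.cast_nonneg N)), ← gridPoint_succ] at this
  -- The oscillations of a monotone function over the cells telescope.
  refine (Finset.sum_le_sum hcell).trans (le_of_eq ?_)
  rw [← Finset.sum_mul, ← Finset.mul_sum,
    Finset.sum_range_sub (fun i => g (E.gridPoint N i)), gridPoint_zero, gridPoint_self hN]

/-- Some value of a function in a cell is at least its average. -/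
theorem exists_cellIntegral_le {N i : ℕ} (hN : 0 < N) (hi : i < N) {f p : ℝ → ℝ}
    (hf : E.IsTypeDensity f) (hp : IntervalIntegrable p volume E.tlo E.thi) :
    ∃ τ ∈ Ioo (E.gridPoint N i) (E.gridPoint N (i + 1)),
      E.cellIntegral N (fun t => p t * f t) i ≤ p τ * E.cellIntegral N f i := by
  by_contra! h
  have hlt := gridPoint_lt_succ (E := E) hN i
  have hm := gridPoint_mem (E := E) hN hi.le
  have hm' := gridPoint_mem (E := E) hN hi
  have hsub : uIcc (E.gridPoint N i) (E.gridPoint N (i + 1)) ⊆ uIcc E.tlo E.thi := by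
    rw [uIcc_of_le hlt.le, uIcc_of_le E.tlo_lt_thi.le]
    exact Icc_subset_Icc hm.1 hm'.2
  have hfi : IntervalIntegrable f volume E.tlo E.thi :=
    E.intervalIntegrable_of_types hf.continuousOn E.tlo_mem E.thi_mem
  have hpf : IntervalIntegrable (fun t => p t * f t) volume E.tlo E.thi :=
    hp.mul_continuousOn (by rw [uIcc_of_le E.tlo_lt_thi.le]; exact hf.continuousOn)
  have hpos : 0 < E.cellIntegral N f i := hf.integral_pos hm hm' hlt
  set c := E.cellIntegral N (fun t => p t * f t) i / E.cellIntegral N f i with hc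
  have hint : 0 < ∫ t in E.gridPoint N i..E.gridPoint N (i + 1), (c * f t - p t * f t) := by
    refine intervalIntegral.intervalIntegral_pos_of_pos_on
      (((hfi.mono_set hsub).const_mul _).sub (hpf.mono_set hsub)) (fun t ht => ?_) hlt
    have hft := hf.pos t ⟨hm.1.trans ht.1.le, ht.2.le.trans hm'.2⟩
    have : p t < c := (lt_div_iff₀ hpos).2 (h t ht)
    rw [← sub_mul]
    exact mul_pos (sub_pos.2 this) hft
  rw [intervalIntegral.integral_sub ((hfi.mono_set hsub).const_mul _) (hpf.mono_set hsub),
    intervalIntegral.integral_const_mul] at hint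
  have h1 : c * E.cellIntegral N f i = E.cellIntegral N (fun t => p t * f t) i :=
    div_mul_cancel₀ _ hpos.ne'
  simp only [cellIntegral] at h1 hint
  linarith

theorem IsDominantChain.rankedValues {Z : Set X} (hZ : E.IsDominantChain Z) {τ : ℕ → ℝ}
    (hτ : Monotone τ) (hτm : ∀ i, τ i ∈ E.types) :
    RankedValues (fun (k : Z) i => E.v k (τ i)) fun k => E.rank k where
  nonneg k i := E.v_nonneg _ (hτm i)
  eq_zero k i j h := by
    have : (k : X) = E.outside := by
      by_contra hk
      exact (E.v_pos _ hk _ (hτm i)).ne' h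
    simp only [this]
    exact E.v_outside _ (hτm j)
  mono_type k i j hij := E.monotoneOn_v k (hτm i) (hτm j) (hτ hij)
  mono_rank k l h i := hZ.v_le k k.2 l l.2 h _ (hτm i)
  cross k l i j h hij := hZ.cross k k.2 l l.2 h _ (hτm i) _ (hτm j) (hτ hij)

/-- Replacing each allocation of a mechanism by a lottery over a dominating allocation. -/
theorem IsMechanism.exists_feasible [MeasurableSpace X] {Z : Set X} (hZ : E.IsDominantChain Z)
    {x : ℝ → X} {p : ℝ → ℝ} (h : E.IsMechanism x p) {τ : ℕ → ℝ} (hτ : Monotone τ)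
    (hτm : ∀ i, τ i ∈ E.types) {lo hi : ℝ} (hp : ∀ t ∈ E.types, p t ∈ Icc lo hi) (n : ℕ) :
    ∃ s : ℕ → Z × ℝ × ℝ, Feasible (fun (k : Z) i => E.v k (τ i)) n lo hi s ∧
      ∀ i, payoff (fun (k : Z) i => E.v k (τ i)) (s i) i = E.v (x (τ i)) (τ i) - p (τ i) ∧
        (s i).2.2 = p (τ i) := by
  choose y hyZ hle hcross using hZ.dominates
  let s : ℕ → Z × ℝ × ℝ := fun i => (⟨y (x (τ i)), hyZ _⟩,
    E.v (x (τ i)) (τ i) / E.v (y (x (τ i))) (τ i), p (τ i))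
  have hself : ∀ i, payoff (fun (k : Z) i => E.v k (τ i)) (s i) i =
      E.v (x (τ i)) (τ i) - p (τ i) := fun i => by
    simp only [payoff, worth, s]
    congr 1
    refine div_mul_cancel_of_imp fun h0 => ?_
    exact le_antisymm (h0 ▸ hle _ _ (hτm i)) (E.v_nonneg _ (hτm i))
  refine ⟨s, ⟨fun i => ?_, fun i => hp _ (hτm i), fun i j hij _ => ?_, fun i _ => ?_⟩,
    fun i => ⟨hself i, rfl⟩⟩
  · exact ⟨div_nonneg (E.v_nonneg _ (hτm i)) (E.v_nonneg _ (hτm i)),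
      div_le_one_of_le₀ (hle _ _ (hτm i)) (E.v_nonneg _ (hτm i))⟩
  · rw [hself]
    refine le_trans ?_ (h.ic _ (hτm j) _ (hτm i))
    simp only [payoff, worth, s]
    refine sub_le_sub_right ?_ _
    rcases (E.v_nonneg (y (x (τ i))) (hτm i)).eq_or_lt with h0 | h0
    · rw [← h0, div_zero, zero_mul]
      exact E.v_nonneg _ (hτm j)
    · rw [div_mul_eq_mul_div, div_le_iff₀ h0, mul_comm]
      exact hcross _ _ (hτm i) _ (hτm j) (hτ hij.le)
  · rw [hself]
    exact h.ir _ (hτm i)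

theorem isIncreasing_stepFun {Z : Set X} (hZ : E.IsDominantChain Z) (τ : ℕ → ℝ) (N : ℕ)
    {a : ℕ → X} (ha : ∀ i, a i ∈ Z) (hmono : Monotone fun i => E.rank (a i)) :
    E.IsIncreasing Z (stepFun τ N E.outside a) where
  mem t := by
    unfold stepFun
    split_ifs
    · exact hZ.outside_mem
    · exact ha _
  mono s t hst := by
    classical
    have hcard : ({i ∈ Finset.range N | τ i ≤ s}).card ≤ ({i ∈ Finset.range N | τ i ≤ t}).card :=
      Finset.card_le_card fun i hi => by
        simp only [Finset.mem_filter] at hi ⊢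
        exact ⟨hi.1, hi.2.trans hst⟩
    have key : ∀ b c : ℕ, b ≤ c → E.rank (if b = 0 then E.outside else a (b - 1)) ≤
        E.rank (if c = 0 then E.outside else a (c - 1)) := by
      intro b c hbc
      by_cases hb : b = 0
      · rw [if_pos hb, E.rank_outside]; exact E.rank_nonneg _
      · rw [if_neg hb, if_neg (by omega)]
        exact hmono (by omega)
    have := key _ _ hcard
    simp only [stepFun]
    convert this

/-- The step function assigns the outside option below `τ 0`, so no rents accrue there, and is
constant between sample points, so the discrete rents are exact at each of them. -/
theorem rents_stepFun [CompactSpace X] [MeasurableSpace X] [BorelSpace X] {Z : Set X}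
    (hZ : E.IsDominantChain Z) {τ : ℕ → ℝ} (hτ : Monotone τ) (hτm : ∀ i, τ i ∈ E.types) {N : ℕ}
    {a : ℕ → Z} (hmono : Monotone fun i => E.rank (a i)) :
    ∀ i < N, E.rents (stepFun τ N E.outside fun i => a i) (τ i) =
      rent (fun (k : Z) i => E.v k (τ i)) a i := by
  have hz := isIncreasing_stepFun hZ τ N (a := fun i => a i) (fun i => (a i).2) hmono
  intro i
  induction i with
  | zero =>
    intro _
    rw [rent, Finset.sum_range_zero, rents]
    rw [intervalIntegral.integral_congr_Ioo_of_le (g := fun _ => (0 : ℝ)) (hτm 0).1]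
    · simp
    · intro t ht
      beta_reduce
      rw [stepFun_of_lt hτ ht.2, E.slope_outside (projIcc E.tlo E.thi E.tlo_lt_thi.le t).2]
  | succ i ih =>
    intro hi
    have h1 := rent_succ_sub (fun (k : Z) i => E.v k (τ i)) a i
    have h2 := hz.rents_sub hZ (τ i) (τ (i + 1))
    rw [intervalIntegral.integral_congr_Ioo_of_le (hτ (Nat.le_succ i))
      (g := fun t => E.slope (a i) (projIcc E.tlo E.thi E.tlo_lt_thi.le t)),
      ← E.v_sub_eq_integral _ (hτm i) (hτm _) (hτ (Nat.le_succ i))] at h2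
    · rw [ih (by omega)] at h2
      linarith
    · intro t ht
      beta_reduce
      rw [stepFun_of_mem hτ (by omega) ht.1.le fun _ => ht.2]

end ScreeningEnv

/-! ### Approximation, Helly selection and existence -/

namespace ScreeningEnv

open MeasureTheory Filter Topology FiniteScreening

variable {X : Type*} [MetricSpace X] {E : ScreeningEnv X} {f lam : ℝ → ℝ}

theorem IsWelfareWeight.continuousOn_mul (hlam : E.IsWelfareWeight f lam)
    (hf : E.IsTypeDensity f) : ContinuousOn (fun t => lam t * f t) E.types :=
  hlam.continuousOn.mul hf.continuousOn

/-- The mean of the welfare weight in a cell is between its values at the end points. -/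
theorem IsWelfareWeight.cellIntegral_mem (hlam : E.IsWelfareWeight f lam)
    (hf : E.IsTypeDensity f) {N i : ℕ} (hi : i < N) :
    lam (E.gridPoint N (i + 1)) * E.cellIntegral N f i ≤
        E.cellIntegral N (fun t => lam t * f t) i ∧
      E.cellIntegral N (fun t => lam t * f t) i ≤
        lam (E.gridPoint N i) * E.cellIntegral N f i := by
  have hN : 0 < N := by omega
  have hlt := gridPoint_lt_succ (E := E) hN i
  have hm := gridPoint_mem (E := E) hN hi.le
  have hm' := gridPoint_mem (E := E) hN hi
  have hfi := E.intervalIntegrable_of_types hf.continuousOn hm hm'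
  have hlf := E.intervalIntegrable_of_types (hlam.continuousOn_mul hf) hm hm'
  simp only [cellIntegral, ← intervalIntegral.integral_const_mul]
  constructor
  · refine intervalIntegral.integral_mono_on hlt.le (hfi.const_mul _) hlf fun t ht => ?_
    have htm : t ∈ E.types := ⟨hm.1.trans ht.1, ht.2.trans hm'.2⟩
    exact mul_le_mul_of_nonneg_right (hlam.antitoneOn htm hm' ht.2) (hf.pos t htm).le
  · refine intervalIntegral.integral_mono_on hlt.le hlf (hfi.const_mul _) fun t ht => ?_
    have htm : t ∈ E.types := ⟨hm.1.trans ht.1, ht.2.trans hm'.2⟩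
    exact mul_le_mul_of_nonneg_right (hlam.antitoneOn hm htm ht.1) (hf.pos t htm).le

theorem exists_abs_le_of_continuousOn {φ : ℝ → ℝ} (hφ : ContinuousOn φ E.types) :
    ∃ Φ, ∀ t ∈ E.types, |φ t| ≤ Φ := by
  obtain ⟨Φ, hΦ⟩ := (isCompact_Icc (a := E.tlo) (b := E.thi)).bddAbove_image hφ.abs
  exact ⟨Φ, fun t ht => hΦ ⟨t, ht, rfl⟩⟩

variable [CompactSpace X] [MeasurableSpace X] [BorelSpace X] {Z : Set X}

/-- Increasing assignments within a dominant chain do almost as well as any mechanism. -/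
theorem IsMechanism.exists_isIncreasing (hZ : E.IsDominantChain Z) (hf : E.IsTypeDensity f)
    (hlam : E.IsWelfareWeight f lam) {x : ℝ → X} {p : ℝ → ℝ} (h : E.IsMechanism x p) {ε : ℝ}
    (hε : 0 < ε) : ∃ z, E.IsIncreasing Z z ∧
      E.objective f lam x p ≤ E.objective f lam z (E.payment z) + ε := by
  obtain ⟨C, hC0, hC⟩ := hZ.exists_v_le
  obtain ⟨Φ, hΦ⟩ := exists_abs_le_of_continuousOn hf.continuousOn
  obtain ⟨Λ, hΛ⟩ := exists_abs_le_of_continuousOn (hlam.continuousOn_mul hf)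
  have hΦ0 : 0 ≤ Φ := (abs_nonneg _).trans (hΦ _ E.tlo_mem)
  have hΛ0 : 0 ≤ Λ := (abs_nonneg _).trans (hΛ _ E.tlo_mem)
  -- The three terms are Riemann sum errors: for the payoffs of the mechanism, and for the rents and
  -- the payments of the step assignment.
  obtain ⟨N, hN, hNε⟩ : ∃ N : ℕ, 0 < N ∧
      (Λ * C + Λ * C + Φ * C) * ((E.thi - E.tlo) / N) ≤ ε := by
    obtain ⟨N, hN⟩ := exists_nat_gt ((Λ * C + Λ * C + Φ * C) * (E.thi - E.tlo) / ε)
    have hnum : 0 ≤ (Λ * C + Λ * C + Φ * C) * (E.thi - E.tlo) :=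
      mul_nonneg (by positivity) (sub_nonneg.2 E.tlo_lt_thi.le)
    have hNpos : (0 : ℝ) < N := (div_nonneg hnum hε.le).trans_lt hN
    refine ⟨N, by exact_mod_cast hNpos, ?_⟩
    rw [← mul_div_assoc, div_le_iff₀ hNpos]
    rw [div_lt_iff₀ hε] at hN
    linarith
  set w := (E.thi - E.tlo) / N with hw
  have hw0 : 0 ≤ w := div_nonneg (sub_nonneg.2 E.tlo_lt_thi.le) (Nat.cast_nonneg N)
  have hpi := h.intervalIntegrable_pay hC
  -- Payments of an arbitrary mechanism need not be monotone, so sample points are chosen where the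
  -- payment is at least its cell average; payoffs are monotone and tolerate any choice. Indices
  -- past the grid get the top type.
  have hsel : ∀ i, ∃ τ, (i < N → τ ∈ Ioo (E.gridPoint N i) (E.gridPoint N (i + 1)) ∧
      E.cellIntegral N (fun t => p t * f t) i ≤ p τ * E.cellIntegral N f i) ∧
      (N ≤ i → τ = E.thi) := fun i => by
    rcases lt_or_ge i N with hi | hi
    · obtain ⟨τ, h1, h2⟩ := exists_cellIntegral_le hN hi hf hpi
      exact ⟨τ, fun _ => ⟨h1, h2⟩, fun h => absurd hi h.not_gt⟩
    · exact ⟨E.thi, fun h => absurd hi h.not_ge, fun _ => rfl⟩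
  choose τ hτ hτthi using hsel
  have hτcell : ∀ i < N, τ i ∈ Icc (E.gridPoint N i) (E.gridPoint N (i + 1)) := fun i hi =>
    Ioo_subset_Icc_self (hτ i hi).1
  have hτm : ∀ i, τ i ∈ E.types := fun i => by
    rcases lt_or_ge i N with hi | hi
    · exact Icc_subset_Icc (gridPoint_mem hN hi.le).1 (gridPoint_mem hN hi).2 (hτcell i hi)
    · rw [hτthi i hi]; exact E.thi_mem
  have hτmono : Monotone τ := monotone_nat_of_le_succ fun i => by
    rcases lt_or_ge (i + 1) N with hi | hi
    · exact (hτcell i (by omega)).2.trans (hτcell (i + 1) hi).1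
    · rw [hτthi _ hi]; exact (hτm i).2
  let m : ℕ → ℝ := E.cellIntegral N f
  -- Cell averages of the weight preserve its mean exactly, so the bound by one carries over, and
  -- they still decrease.
  let l : ℕ → ℝ := fun i => E.cellIntegral N (fun t => lam t * f t) i / m i
  have hm : ∀ i < N, 0 < m i := fun i hi =>
    hf.integral_pos (gridPoint_mem hN hi.le) (gridPoint_mem hN hi) (gridPoint_lt_succ hN i)
  have hml : ∀ i < N, m i * l i = E.cellIntegral N (fun t => lam t * f t) i := fun i hi =>
    mul_div_cancel₀ _ (hm i hi).ne'
  have hl1 : ∀ i < N, lam (E.gridPoint N (i + 1)) ≤ l i := fun i hi =>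
    (le_div_iff₀ (hm i hi)).2 (hlam.cellIntegral_mem hf hi).1
  have hl2 : ∀ i < N, l i ≤ lam (E.gridPoint N i) := fun i hi =>
    (div_le_iff₀ (hm i hi)).2 (hlam.cellIntegral_mem hf hi).2
  have hl0 : ∀ i < N, 0 ≤ l i := fun i hi =>
    (hlam.nonneg _ (gridPoint_mem hN hi)).trans (hl1 i hi)
  have hlanti : ∀ i j, i ≤ j → j < N → l j ≤ l i := fun i j hij hj => by
    rcases hij.eq_or_lt with rfl | hij
    · exact le_rfl
    · exact (hl2 j hj).trans ((hlam.antitoneOn (gridPoint_mem hN (by omega))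
        (gridPoint_mem hN hj.le) (monotone_gridPoint hN hij)).trans (hl1 i (hij.trans hj)))
  have hmean : ∑ i ∈ Finset.range N, m i * l i ≤ ∑ i ∈ Finset.range N, m i := by
    rw [Finset.sum_congr rfl fun i hi => hml i (Finset.mem_range.1 hi),
      sum_cellIntegral hN (E.intervalIntegrable_of_types (hlam.continuousOn_mul hf)
        E.tlo_mem E.thi_mem),
      sum_cellIntegral hN (E.intervalIntegrable_of_types hf.continuousOn E.tlo_mem E.thi_mem),
      hf.integral_eq_one]
    exact hlam.expect_le_one
  have : CompactSpace Z := isCompact_iff_compactSpace.1 hZ.isCompact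
  obtain ⟨s, hs, hsval⟩ := h.exists_feasible hZ hτmono hτm (fun t ht => h.pay_mem hC ht) N
  obtain ⟨a, hamono, hle⟩ := exists_increasing (hZ.rankedValues hτmono hτm)
    (fun i => continuousOn_iff_continuous_domRestrict.1 (hZ.continuousOn_v _ (hτm i)))
    (E.continuous_rank.comp continuous_subtype_val) (bot := ⟨E.outside, hZ.outside_mem⟩)
    (fun i => E.v_outside _ (hτm i)) (fun k => by rw [E.rank_outside]; exact E.rank_nonneg _)
    hm hl0 hlanti hmean hs
  set z := stepFun τ N E.outside fun i => (a i : X) with hz_def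
  have hz : E.IsIncreasing Z z := isIncreasing_stepFun hZ τ N (fun i => (a i).2) hamono
  have hrent := rents_stepFun hZ hτmono hτm (N := N) hamono
  have hpay : ∀ i < N, E.payment z (τ i) =
      E.v (a i) (τ i) - rent (fun (k : Z) i => E.v k (τ i)) a i := fun i hi => by
    rw [payment, hrent i hi, hz_def, stepFun_of_mem hτmono hi le_rfl]
    exact fun hi' => (hτ i hi).1.2.trans (hτ _ hi').1.1
  refine ⟨z, hz, ?_⟩
  have b1 := abs_le.1 (abs_integral_sub_sum_le hN (hlam.continuousOn_mul hf) hΛ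
    h.monotoneOn_payoff hτcell)
  have b2 := abs_le.1 (abs_integral_sub_sum_le hN (hlam.continuousOn_mul hf) hΛ
    (hz.monotoneOn_rents hZ) hτcell)
  have b3 := abs_le.1 (abs_integral_sub_sum_le hN hf.continuousOn hΦ
    (hz.monotoneOn_payment hZ) hτcell)
  have e1 : Λ * ((E.v (x E.thi) E.thi - p E.thi) - (E.v (x E.tlo) E.tlo - p E.tlo)) * w ≤
      Λ * C * w :=
    mul_le_mul_of_nonneg_right (mul_le_mul_of_nonneg_left (h.payoff_sub_le hC) hΛ0) hw0
  have e2 : Λ * (E.rents z E.thi - E.rents z E.tlo) * w ≤ Λ * C * w := by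
    refine mul_le_mul_of_nonneg_right (mul_le_mul_of_nonneg_left ?_ hΛ0) hw0
    linarith [hz.rents_nonneg hZ E.tlo_mem, hz.rents_le hZ hC E.thi_mem]
  have e3 : Φ * (E.payment z E.thi - E.payment z E.tlo) * w ≤ Φ * C * w := by
    refine mul_le_mul_of_nonneg_right (mul_le_mul_of_nonneg_left ?_ hΦ0) hw0
    linarith [hz.payment_nonneg hZ E.tlo_mem, hz.payment_le hZ hC E.thi_mem]
  have hobj : E.objective f lam x p =
      (∫ t in E.tlo..E.thi, (E.v (x t) t - p t) * (lam t * f t)) +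
        ∫ t in E.tlo..E.thi, p t * f t := by
    simp only [objective, expect]
    congr 2
    ext t
    ring
  have hpsum : ∫ t in E.tlo..E.thi, p t * f t ≤ ∑ i ∈ Finset.range N, p (τ i) * m i := by
    rw [← sum_cellIntegral hN (hpi.mul_continuousOn
      (by rw [uIcc_of_le E.tlo_lt_thi.le]; exact hf.continuousOn))]
    exact Finset.sum_le_sum fun i hi => (hτ i (Finset.mem_range.1 hi)).2
  have c1 : welfare (fun (k : Z) i => E.v k (τ i)) m l N s =
      ∑ i ∈ Finset.range N, (E.v (x (τ i)) (τ i) - p (τ i)) *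
        E.cellIntegral N (fun t => lam t * f t) i + ∑ i ∈ Finset.range N, p (τ i) * m i := by
    rw [← Finset.sum_add_distrib]
    refine Finset.sum_congr rfl fun i hi => ?_
    rw [← hml i (Finset.mem_range.1 hi), contribution, (hsval i).1, (hsval i).2]
    ring
  have c2 : ∑ i ∈ Finset.range N, m i * (l i * rent (fun (k : Z) i => E.v k (τ i)) a i +
      (E.v (a i) (τ i) - rent (fun (k : Z) i => E.v k (τ i)) a i)) =
      ∑ i ∈ Finset.range N, E.rents z (τ i) * E.cellIntegral N (fun t => lam t * f t) i +
        ∑ i ∈ Finset.range N, E.payment z (τ i) * m i := by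
    rw [← Finset.sum_add_distrib]
    refine Finset.sum_congr rfl fun i hi => ?_
    have hi' := Finset.mem_range.1 hi
    rw [← hml i hi', hpay i hi', hrent i hi']
    ring
  rw [c1, c2] at hle
  rw [hobj, objective_payment]
  have hsum : Λ * C * w + Λ * C * w + Φ * C * w ≤ ε := by linarith
  linarith [b1.2, b2.1, b3.1]

omit [CompactSpace X] [MeasurableSpace X] [BorelSpace X] in
theorem IsDominantChain.tendsto_of_rank (hZ : E.IsDominantChain Z) {u : ℕ → X} {y : X}
    (hu : ∀ n, u n ∈ Z) (hy : y ∈ Z)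
    (h : Tendsto (fun n => E.rank (u n)) atTop (𝓝 (E.rank y))) : Tendsto u atTop (𝓝 y) := by
  have : CompactSpace Z := isCompact_iff_compactSpace.1 hZ.isCompact
  have hemb := ((E.continuous_rank.comp continuous_subtype_val).isClosedEmbedding
      (injOn_iff_injective.1 hZ.rank_injOn)).isEmbedding
  have h1 : Tendsto (fun n => (⟨u n, hu n⟩ : Z)) atTop (𝓝 ⟨y, hy⟩) :=
    hemb.tendsto_nhds_iff.2 h
  exact (continuous_subtype_val.tendsto _).comp h1

omit [CompactSpace X] [MeasurableSpace X] [BorelSpace X] in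
/-- Helly's selection principle for increasing assignments. -/
theorem IsDominantChain.exists_subseq_tendsto (hZ : E.IsDominantChain Z) {u : ℕ → ℝ → X}
    (hu : ∀ n, E.IsIncreasing Z (u n)) : ∃ z, E.IsIncreasing Z z ∧ ∃ φ : ℕ → ℕ, StrictMono φ ∧
      ∀ᵐ t, Tendsto (fun n => u (φ n) t) atTop (𝓝 (z t)) := by
  have : CompactSpace Z := isCompact_iff_compactSpace.1 hZ.isCompact
  -- Sequential compactness of the countable power of the chain gives convergence at all rational
  -- types at once.
  obtain ⟨ζ, φ, hφ, hlim⟩ := CompactSpace.tendsto_subseq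
    (fun n (q : ℚ) => (⟨u n q, (hu n).mem q⟩ : Z))
  have hrank : ∀ q : ℚ, Tendsto (fun n => E.rank (u (φ n) q)) atTop (𝓝 (E.rank (ζ q))) :=
    fun q => ((E.continuous_rank.comp continuous_subtype_val).tendsto (ζ q)).comp
      ((tendsto_pi_nhds.1 hlim) q)
  have hζ : Monotone fun q => E.rank (ζ q) := fun q r hqr =>
    le_of_tendsto_of_tendsto' (hrank q) (hrank r) fun n => (hu _).mono (Rat.cast_le.2 hqr)
  have hcpt : IsCompact (E.rank '' Z) := hZ.isCompact.image E.continuous_rank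
  have hsub : ∀ t : ℝ, (fun q => E.rank (ζ q)) '' {q : ℚ | (q : ℝ) ≤ t} ⊆ E.rank '' Z := by
    rintro t _ ⟨q, -, rfl⟩
    exact ⟨ζ q, (ζ q).2, rfl⟩
  have hne : ∀ t : ℝ, ((fun q => E.rank (ζ q)) '' {q : ℚ | (q : ℝ) ≤ t}).Nonempty := fun t => by
    obtain ⟨q, hq⟩ := exists_rat_lt t
    exact ⟨_, q, hq.le, rfl⟩
  have hlub : ∀ t : ℝ, IsLUB ((fun q => E.rank (ζ q)) '' {q : ℚ | (q : ℝ) ≤ t})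
      (sSup ((fun q => E.rank (ζ q)) '' {q : ℚ | (q : ℝ) ≤ t})) := fun t =>
    isLUB_csSup (hne t) (hcpt.bddAbove.mono (hsub t))
  -- The supremum is itself a rank because the ranks of the chain form a closed set.
  have hex : ∀ t : ℝ, ∃ y ∈ Z, E.rank y = sSup ((fun q => E.rank (ζ q)) '' {q : ℚ | (q : ℝ) ≤ t}) :=
    fun t => closure_minimal (hsub t) hcpt.isClosed ((hlub t).mem_closure (hne t))
  choose z hzZ hz using hex
  have hmono : Monotone fun t => E.rank (z t) := fun s t hst => by
    simp only [hz]
    refine csSup_le_csSup (hcpt.bddAbove.mono (hsub t)) (hne s) (image_mono ?_)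
    exact fun q hq => le_trans hq hst
  have hzq : ∀ q : ℚ, E.rank (z q) = E.rank (ζ q) := fun q => by
    rw [hz]
    refine (hlub q).unique ⟨?_, fun b hb => hb ⟨q, le_refl (q : ℝ), rfl⟩⟩
    rintro _ ⟨r, hr, rfl⟩
    exact hζ (Rat.cast_le.1 (show (r : ℝ) ≤ q from hr))
  refine ⟨z, ⟨hzZ, hmono⟩, φ, hφ, ?_⟩
  -- At a continuity point of the limiting rank, nearby rationals on either side pin down the limit.
  filter_upwards [hmono.countable_not_continuousAt.ae_notMem volume] with t ht
  simp only [not_not] at ht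
  refine hZ.tendsto_of_rank (fun n => (hu _).mem t) (hzZ t) (tendsto_order.2 ⟨fun b hb => ?_,
    fun b hb => ?_⟩)
  · have h1 := (tendsto_order.1 ht.tendsto).1 b hb
    obtain ⟨r, hr, hrt⟩ := mem_nhdsLE_iff_exists_Ioc_subset.1 (mem_nhdsWithin_of_mem_nhds h1)
    obtain ⟨q, hq1, hq2⟩ := exists_rat_btwn (mem_Iio.1 hr)
    have h2 : b < E.rank (ζ q) := hzq q ▸ hrt ⟨hq1, hq2.le⟩
    filter_upwards [(tendsto_order.1 (hrank q)).1 b h2] with n hn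
    exact hn.trans_le ((hu _).mono hq2.le)
  · have h1 := (tendsto_order.1 ht.tendsto).2 b hb
    obtain ⟨r, hr, hrt⟩ := mem_nhdsGE_iff_exists_Ico_subset.1 (mem_nhdsWithin_of_mem_nhds h1)
    obtain ⟨q, hq1, hq2⟩ := exists_rat_btwn (mem_Ioi.1 hr)
    have h2 : E.rank (ζ q) < b := hzq q ▸ hrt ⟨hq1.le, hq2⟩
    filter_upwards [(tendsto_order.1 (hrank q)).2 b h2] with n hn
    exact ((hu _).mono hq1.le).trans_lt hn

/-- Continuity of the objective of increasing assignments. -/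
theorem IsDominantChain.tendsto_objective (hZ : E.IsDominantChain Z) (hf : E.IsTypeDensity f)
    (hlam : E.IsWelfareWeight f lam) {u : ℕ → ℝ → X} (hu : ∀ n, E.IsIncreasing Z (u n))
    {z : ℝ → X} (hz : E.IsIncreasing Z z) (h : ∀ᵐ t, Tendsto (fun n => u n t) atTop (𝓝 (z t))) :
    Tendsto (fun n => E.objective f lam (u n) (E.payment (u n))) atTop
      (𝓝 (E.objective f lam z (E.payment z))) := by
  obtain ⟨C, hC0, hC⟩ := hZ.exists_v_le
  obtain ⟨L, hL0, hL⟩ := E.exists_slope_le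
  have huIcc : uIcc E.tlo E.thi = E.types := uIcc_of_le E.tlo_lt_thi.le
  have huIoc : ∀ t ∈ uIoc E.tlo E.thi, t ∈ E.types := fun t ht => by
    rw [uIoc_of_le E.tlo_lt_thi.le] at ht
    exact Ioc_subset_Icc_self ht
  have hrents : ∀ t, Tendsto (fun n => E.rents (u n) t) atTop (𝓝 (E.rents z t)) := fun t => by
    refine intervalIntegral.tendsto_integral_filter_of_dominated_convergence (fun _ => L)
      (Eventually.of_forall fun n => ((hu n).measurable_slope hZ).aestronglyMeasurable)
      (Eventually.of_forall fun n => Eventually.of_forall fun s _ => ?_)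
      intervalIntegrable_const ?_
    · rw [Real.norm_of_nonneg (E.slope_nonneg _ _)]
      exact hL _ _ (projIcc E.tlo E.thi E.tlo_lt_thi.le s).2
    · filter_upwards [h] with s hs _
      exact ((E.continuous_slope (projIcc E.tlo E.thi E.tlo_lt_thi.le s).2).tendsto _).comp hs
  have key : ∀ {g : ℕ → ℝ → ℝ} {g₀ φ : ℝ → ℝ}, ContinuousOn φ E.types →
      (∀ n, MonotoneOn (g n) E.types) → (∀ n, ∀ t ∈ E.types, |g n t| ≤ C) →
      (∀ᵐ t, t ∈ E.types → Tendsto (fun n => g n t) atTop (𝓝 (g₀ t))) →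
      Tendsto (fun n => ∫ t in E.tlo..E.thi, g n t * φ t) atTop
        (𝓝 (∫ t in E.tlo..E.thi, g₀ t * φ t)) := by
    intro g g₀ φ hφ hg hgC hlim
    refine intervalIntegral.tendsto_integral_filter_of_dominated_convergence
      (fun t => C * |φ t|) (Eventually.of_forall fun n => ?_)
      (Eventually.of_forall fun n => Eventually.of_forall fun t ht => ?_) ?_ ?_
    · exact (intervalIntegrable_iff.1 ((MonotoneOn.intervalIntegrable
        (huIcc ▸ hg n)).mul_continuousOn (huIcc ▸ hφ))).aestronglyMeasurable
    · rw [norm_mul]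
      exact mul_le_mul_of_nonneg_right (hgC n t (huIoc t ht)) (abs_nonneg _)
    · exact (E.intervalIntegrable_of_types hφ.abs E.tlo_mem E.thi_mem).const_mul C
    · filter_upwards [hlim] with t ht htm
      exact (ht (huIoc t htm)).mul_const _
  simp only [objective_payment]
  refine (key (hlam.continuousOn_mul hf) (fun n => (hu n).monotoneOn_rents hZ) (fun n t ht => ?_)
    (Eventually.of_forall fun t _ => hrents t)).add
    (key hf.continuousOn (fun n => (hu n).monotoneOn_payment hZ) (fun n t ht => ?_) ?_)
  · rw [abs_of_nonneg ((hu n).rents_nonneg hZ ht)]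
    exact (hu n).rents_le hZ hC ht
  · rw [abs_of_nonneg ((hu n).payment_nonneg hZ ht)]
    exact (hu n).payment_le hZ hC ht
  · filter_upwards [h] with t ht htm
    refine Tendsto.sub ?_ (hrents t)
    exact (hZ.continuousOn_v t htm (z t) (hz.mem t)).tendsto.comp
      (tendsto_nhdsWithin_iff.2 ⟨ht, Eventually.of_forall fun n => (hu n).mem t⟩)

/-- Some increasing assignment within a dominant chain is optimal. -/
theorem IsDominantChain.exists_isOptimalMechanism (hZ : E.IsDominantChain Z)
    (hf : E.IsTypeDensity f) (hlam : E.IsWelfareWeight f lam) :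
    ∃ z, E.IsIncreasing Z z ∧ E.IsOptimalMechanism f lam z (E.payment z) := by
  let V : Set ℝ := {r | ∃ z, E.IsIncreasing Z z ∧ E.objective f lam z (E.payment z) = r}
  have hne : V.Nonempty :=
    ⟨_, fun _ => E.outside, ⟨fun _ => hZ.outside_mem, monotone_const⟩, rfl⟩
  have hconv : ∀ u : ℕ → ℝ → X, (∀ n, E.IsIncreasing Z (u n)) → ∃ z, E.IsIncreasing Z z ∧
      ∃ φ : ℕ → ℕ, StrictMono φ ∧ Tendsto (fun n => E.objective f lam (u (φ n))
        (E.payment (u (φ n)))) atTop (𝓝 (E.objective f lam z (E.payment z))) := fun u hu => by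
    obtain ⟨z, hz, φ, hφ, hlim⟩ := hZ.exists_subseq_tendsto hu
    exact ⟨z, hz, φ, hφ, hZ.tendsto_objective hf hlam (fun n => hu (φ n)) hz hlim⟩
  -- Values tending to infinity would contradict the existence of a subsequence with convergent
  -- values.
  have hbdd : BddAbove V := by
    by_contra hV
    have hlarge : ∀ n : ℕ, ∃ z, E.IsIncreasing Z z ∧
        (n : ℝ) < E.objective f lam z (E.payment z) := fun n => by
      obtain ⟨_, ⟨z, hz, rfl⟩, hlt⟩ := not_bddAbove_iff.1 hV n
      exact ⟨z, hz, hlt⟩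
    choose u hu hlt using hlarge
    obtain ⟨z, -, φ, hφ, hlim⟩ := hconv u hu
    refine not_tendsto_nhds_of_tendsto_atTop ?_ _ hlim
    exact tendsto_atTop_mono (fun n => (hlt (φ n)).le)
      (tendsto_natCast_atTop_atTop.comp hφ.tendsto_atTop)
  obtain ⟨r, -, hr, hrV⟩ := exists_seq_tendsto_sSup hne hbdd
  choose u hu hur using hrV
  obtain ⟨z, hz, φ, hφ, hlim⟩ := hconv u hu
  have hval : E.objective f lam z (E.payment z) = sSup V := by
    refine tendsto_nhds_unique hlim ?_
    simp only [hur]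
    exact hr.comp hφ.tendsto_atTop
  refine ⟨z, hz, hz.isMechanism hZ, fun x p hxp => le_of_forall_pos_le_add fun ε hε => ?_⟩
  obtain ⟨z', hz', hle⟩ := hxp.exists_isIncreasing hZ hf hlam hε
  rw [hval]
  exact hle.trans (add_le_add_left (le_csSup hbdd ⟨z', hz', rfl⟩) ε)

end ScreeningEnv

theorem theorem1 {X : Type*} [MetricSpace X] [CompactSpace X] [MeasurableSpace X] [BorelSpace X]
    (E : ScreeningEnv X) (f₀ : ℝ → ℝ) (hf₀ : E.IsTypeDensity f₀)
    (Xstar : Set X) (hXstar : E.IsFrontier f₀ Xstar)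
    (f : ℝ → ℝ) (hf : E.IsTypeDensity f)
    (lam : ℝ → ℝ) (hlam : E.IsWelfareWeight f lam) :
    E.IsOptimalMenu f lam Xstar := by
  obtain ⟨z, hz, hopt⟩ := (hXstar.isDominantChain hf₀).exists_isOptimalMechanism hf hlam
  exact ⟨z, E.payment z, hopt, fun t _ => hz.mem t⟩
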